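/- Let $\mathfrak F\subset\mathbb N\times\mathbb N$ ($\mathbb N=\{0,1,2,\dots\}$) contain a sequence $(\tilde p_n,\tilde q_n)$ with $\tilde p_n\to+\infty$. Let $\Omega\subset\mathbb C$ be a simply connected domain, let $\zeta\in\Omega$ be fixed, and let $\mathcal H(\Omega)$ be the space of holomorphic functions on $\Omega$ with the topology of uniform convergence on compact subsets of $\Omega$. For $f\in\mathcal H(\Omega)$ let $a_\nu=f^{(\nu)}(\zeta)/\nu!$ for $\nu\ge 0$ and $a_\nu=0$ for $\nu<0$. For $p,q\in\mathbb N$ write $f\in\mathfrak D_{p,q}(\zeta)$ if $\det\big(a_{p-q+1+i+j}\big)_{0\le i,j\le q-1}\ne 0$ (this holds automatically for $q=0$). The Padé approximant $[p/q]_{f,\zeta}$ is the rational function $A/B$, where $A,B$ are polynomials with $\deg A\le p$, $\deg B\le q$, $B(\zeta)=1$, such that the Taylor coefficients of $A/B$ at $\zeta$ of orders $0,1,\dots,p+q$ are $a_0,\dots,a_{p+q}$; it is unique if it exists, and it exists when $f\in\mathfrak D_{p,q}(\zeta)$. A supremum of $|[p/q]_{f,\zeta}-g|$ over a set that contains a pole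 of $[p/q]_{f,\zeta}$ is $+\infty$. Then there exists $f\in\mathcal H(\Omega)$ such that for every polynomial $h$ and every compact set $K\subset\mathbb C\setminus\Omega$ with connected complement $\mathbb C\setminus K$ there exists a sequence $(p_n,q_n)\in\mathfrak F$, $n=1,2,\dots$, such that 1. $f\in\mathfrak D_{p_n,q_n}(\zeta)$ for all $n$, 2. $\sup_{z\in K}\big|[p_n/q_n]_{f,\zeta}(z)-h(z)\big|\to 0$ as $n\to\infty$, and 3. for every compact set $L'\subset\Omega$, $\sup_{z\in L'}\big|[p_n/q_n]_{f,\zeta}(z)-f(z)\big|\to 0$ as $n\to\infty$. Moreover, the set of all such functions $f$ is dense and $G_\delta$ in $\mathcal H(\Omega)$. -/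

import Mathlib

open Polynomial Filter Topology
open scoped ENNReal

/-- `ℋ(Ω)`: the functions holomorphic in the open set `Ω ⊆ ℂ`, as a subspace of `C(Ω, ℂ)`. It carries
the subspace topology of the compact-open topology, which is the topology of uniform convergence on
the compact subsets of `Ω`. -/
abbrev HolFun (Ω : Set ℂ) : Type :=
  {f : C(Ω, ℂ) // DifferentiableOn ℂ (Function.extend Subtype.val f 0) Ω}

/-- An element of `ℋ(Ω)` as a function on `ℂ`, with the (irrelevant) value `0` off `Ω`. -/
noncomputable def HolFun.toFun {Ω : Set ℂ} (f : HolFun Ω) : ℂ → ℂ :=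
  Function.extend Subtype.val f.1 0

/-- The Taylor series `∑ F⁽ᵛ⁾(ζ) / ν! (z - ζ)ᵛ` of `F` with centre `ζ`, as a formal power series in
the variable `z - ζ`. -/
noncomputable def taylorSeriesAt (F : ℂ → ℂ) (ζ : ℂ) : PowerSeries ℂ :=
  PowerSeries.mk fun ν => iteratedDeriv ν F ζ / (ν.factorial : ℂ)

/-- The coefficient `a_k` of a formal power series for an integer index, with `a_k = 0` for
`k < 0`. -/
noncomputable def intCoeff (a : PowerSeries ℂ) (k : ℤ) : ℂ :=
  if 0 ≤ k then PowerSeries.coeff k.toNat a else 0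

/-- The `q × q` Hankel matrix with first row `a_{p-q+1}, …, a_p` and last row
`a_p, …, a_{p+q-1}`. -/
noncomputable def hankelMatrix (a : PowerSeries ℂ) (p q : ℕ) : Matrix (Fin q) (Fin q) ℂ :=
  Matrix.of fun i j => intCoeff a ((p : ℤ) - q + 1 + (i : ℕ) + (j : ℕ))

/-- The class `𝔇_{p,q}`: the Hankel determinant of the series does not vanish (for `q = 0` it is
the empty determinant `1`). -/
def MemPadeD (a : PowerSeries ℂ) (p q : ℕ) : Prop :=
  (hankelMatrix a p q).det ≠ 0

/-- The Taylor expansion with centre `ζ`, as a formal power series in `z - ζ`, of the rational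
function `A / B`, for polynomials `A`, `B` with `B(ζ) ≠ 0`. -/
noncomputable def ratTaylorSeries (A B : ℂ[X]) (ζ : ℂ) : PowerSeries ℂ :=
  (taylor ζ A : PowerSeries ℂ) * (taylor ζ B : PowerSeries ℂ)⁻¹

/-- `Φ` is the Padé approximant `[p/q]` of the formal power series `a = ∑ a_ν (z - ζ)ᵛ` with centre
`ζ`: `Φ = A / B` for polynomials with `deg A ≤ p`, `deg B ≤ q`, `B(ζ) = 1`, such that the Taylor
expansion of `A / B` at `ζ` has coefficients `a_ν` for `ν = 0, …, p + q`. -/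
def IsPadeApproximant (a : PowerSeries ℂ) (ζ : ℂ) (p q : ℕ) (Φ : RatFunc ℂ) : Prop :=
  ∃ A B : ℂ[X], A.natDegree ≤ p ∧ B.natDegree ≤ q ∧ B.eval ζ = 1 ∧
    Φ = algebraMap ℂ[X] (RatFunc ℂ) A / algebraMap ℂ[X] (RatFunc ℂ) B ∧
    ∀ ν ≤ p + q, PowerSeries.coeff ν (ratTaylorSeries A B ζ) = PowerSeries.coeff ν a

/-- A Padé approximant is unique as a rational function. -/
theorem IsPadeApproximant.unique {a : PowerSeries ℂ} {ζ : ℂ} {p q : ℕ} {Φ Ψ : RatFunc ℂ}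
    (h₁ : IsPadeApproximant a ζ p q Φ) (h₂ : IsPadeApproximant a ζ p q Ψ) : Φ = Ψ := by
  obtain ⟨A, B, hA, hB, hB1, rfl, hc⟩ := h₁
  obtain ⟨C, D, hC, hD, hD1, rfl, hd⟩ := h₂
  have hB0 : B ≠ 0 := by rintro rfl; simp at hB1
  have hD0 : D ≠ 0 := by rintro rfl; simp at hD1
  have key : ∀ P Q : ℂ[X], Q.eval ζ = 1 →
      (taylor ζ P : PowerSeries ℂ) = ratTaylorSeries P Q ζ * (taylor ζ Q : PowerSeries ℂ) := by
    intro P Q hQ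
    unfold ratTaylorSeries
    rw [mul_assoc, PowerSeries.inv_mul_cancel, mul_one]
    rw [← PowerSeries.coeff_zero_eq_constantCoeff_apply, Polynomial.coeff_coe,
      Polynomial.taylor_coeff_zero, hQ]
    exact one_ne_zero
  have hdvd : (PowerSeries.X : PowerSeries ℂ) ^ (p + q + 1) ∣
      ratTaylorSeries A B ζ - ratTaylorSeries C D ζ := by
    rw [PowerSeries.X_pow_dvd_iff]
    intro m hm
    rw [map_sub, hc m (by omega), hd m (by omega), sub_self]
  have hE : taylor ζ (A * D - C * B) = 0 := by
    ext m
    rw [Polynomial.coeff_zero]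
    by_cases hm : m < p + q + 1
    · have h3 : (taylor ζ (A * D - C * B) : PowerSeries ℂ) =
          (ratTaylorSeries A B ζ - ratTaylorSeries C D ζ) *
            ((taylor ζ B : PowerSeries ℂ) * (taylor ζ D : PowerSeries ℂ)) := by
        rw [map_sub, taylor_mul, taylor_mul, Polynomial.coe_sub, Polynomial.coe_mul,
          Polynomial.coe_mul, key A B hB1, key C D hD1]
        ring
      rw [← Polynomial.coeff_coe, h3]
      exact PowerSeries.X_pow_dvd_iff.1 (dvd_mul_of_dvd_left hdvd _) m hm
    · apply Polynomial.coeff_eq_zero_of_natDegree_lt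
      rw [Polynomial.natDegree_taylor]
      have h1 : (A * D).natDegree ≤ p + q := Polynomial.natDegree_mul_le.trans (by omega)
      have h2 : (C * B).natDegree ≤ p + q := Polynomial.natDegree_mul_le.trans (by omega)
      have := Polynomial.natDegree_sub_le_of_le h1 h2
      simp only [max_self] at this
      omega
  have hAD : A * D = C * B := by
    have := (map_eq_zero_iff (taylor ζ) (taylor_injective ζ)).1 hE
    exact sub_eq_zero.1 this
  rw [div_eq_div_iff (by simpa using hB0) (by simpa using hD0), ← map_mul, ← map_mul, hAD]

/-- `sup_{z ∈ E} |Φ(z) - g(z)|` as an element of `[0, ∞]`; a pole of `Φ` in `E` makes it `∞`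
(`Φ.denom` is the denominator of `Φ` in lowest terms, so its zeros are the poles of `Φ`). -/
noncomputable def ratSupDist (Φ : RatFunc ℂ) (g : ℂ → ℂ) (E : Set ℂ) : ℝ≥0∞ :=
  open Classical in
  ⨆ z ∈ E, if Φ.denom.eval z = 0 then ⊤ else ‖Φ.eval (RingHom.id ℂ) z - g z‖ₑ

/-- The universality property of `f ∈ ℋ(Ω)`, for the index set `𝔉` and the centre `ζ`: for every
polynomial `h` and every compact `K ⊆ ℂ ∖ Ω` with connected complement there is a sequence
`(p_n, q_n)` in `𝔉` such that `f ∈ 𝔇_{p_n,q_n}(ζ)` for all `n` and the Padé approximants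
`[p_n/q_n]_{f,ζ}` converge to `h` uniformly on `K` and to `f` uniformly on every compact subset
of `Ω`. -/
def IsPadeUniversal (𝔉 : Set (ℕ × ℕ)) (Ω : Set ℂ) (ζ : ℂ) (f : HolFun Ω) : Prop :=
  ∀ h : ℂ[X], ∀ K : Set ℂ, IsCompact K → K ⊆ Ωᶜ → IsConnected Kᶜ →
    ∃ (p q : ℕ → ℕ) (Φ : ℕ → RatFunc ℂ),
      (∀ n, (p n, q n) ∈ 𝔉) ∧
      (∀ n, MemPadeD (taylorSeriesAt f.toFun ζ) (p n) (q n)) ∧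
      (∀ n, IsPadeApproximant (taylorSeriesAt f.toFun ζ) ζ (p n) (q n) (Φ n)) ∧
      Tendsto (fun n => ratSupDist (Φ n) (fun z => h.eval z) K) atTop (𝓝 0) ∧
      ∀ L : Set ℂ, IsCompact L → L ⊆ Ω →
        Tendsto (fun n => ratSupDist (Φ n) f.toFun L) atTop (𝓝 0)

/-! The proof is a Baire category argument: universality amounts to membership in countably many
open dense sets, one for each target compact, target polynomial and accuracy.

Openness. Where the Hankel determinant is nonzero, Cramer's rule gives numerator `A` and denominator
`B` whose coefficients depend continuously on finitely many Taylor coefficients of `f`, hence on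
`f`. The closeness conditions are written without division, as `‖A - g B‖ < ε ‖B‖`. This strict
inequality excludes zeros of `B`, and by compactness it survives small changes of `f`
(`isOpen_padeApproxSet`).

Density. A Runge theorem (`exists_polynomial_near`) gives a polynomial `P` close to a given `f` on a
compact part of `Ω` and close to `h` on `K`. Adding a tiny multiple of `(z - ζ) ^ p` with `p > deg
P` gives `Q` whose coefficient of order `p` at `ζ` is nonzero and whose later ones vanish. Then `Q`
lies in `𝔇_{p,q}` for every `q` and is its own Padé approximant, so only the unboundedness of `p` in
`𝔉` matters (`dense_padeApproxSet`).

Countability. Compacts `K` with connected complement are absorbed by a countable family of the same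
kind (`exists_subset_outerCompact`), and polynomials are separable for uniform convergence on
compacts.

Runge's theorem is proved with the topology encoded by continuous logarithms of `z - w`. These pass
to disjoint unions of compacts, and their existence for every `w` off the compact makes every `(z -
w)⁻¹` a uniform limit of polynomials (`invMemPolyClosure_of_hasContLog`). The Cauchy–Pompeiu formula
then handles general functions. -/

/-! ### Continuous logarithms of `z - w` -/

/-- `z - w` has a continuous logarithm on `X`. -/
def HasContLog (X : Set ℂ) (w : ℂ) : Prop :=
  ∃ u : ℂ → ℂ, ContinuousOn u X ∧ ∀ z ∈ X, Complex.exp (u z) = z - w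

/-- The quotient `(z - w') / (z - w) = 1 - (w' - w) / (z - w)` stays in the unit disc about `1`,
where the principal logarithm is continuous. -/
theorem HasContLog.near {X : Set ℂ} {w w' : ℂ} (h : HasContLog X w)
    (hw : ∀ z ∈ X, ‖w' - w‖ < ‖z - w‖) : HasContLog X w' := by
  obtain ⟨u, hu, he⟩ := h
  have hne : ∀ z ∈ X, z - w ≠ 0 := fun z hz h0 => by
    have := hw z hz
    rw [h0, norm_zero] at this
    exact absurd this (not_lt.2 (norm_nonneg _))
  have hs : ∀ z ∈ X, 1 + -((w' - w) / (z - w)) ∈ Complex.slitPlane := fun z hz => by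
    apply Complex.mem_slitPlane_of_norm_lt_one
    rw [norm_neg, norm_div, div_lt_one (norm_pos_iff.2 (hne z hz))]
    exact hw z hz
  refine ⟨fun z => u z + Complex.log (1 + -((w' - w) / (z - w))), hu.add ?_, fun z hz => ?_⟩
  · refine ContinuousOn.clog ?_ hs
    exact continuousOn_const.add
      (continuousOn_const.div (continuousOn_id.sub continuousOn_const) hne).neg
  · rw [Complex.exp_add, he z hz, Complex.exp_log (Complex.slitPlane_ne_zero (hs z hz))]
    have := hne z hz
    field_simp
    ring

theorem HasContLog.far {X : Set ℂ} {w : ℂ} (hw : ∀ z ∈ X, ‖z‖ < ‖w‖) : HasContLog X w := by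
  rcases X.eq_empty_or_nonempty with rfl | ⟨z₀, hz₀⟩
  · exact ⟨0, continuousOn_empty _, by simp⟩
  have hw0 : w ≠ 0 := fun h => by
    have := hw z₀ hz₀
    rw [h, norm_zero] at this
    exact absurd this (not_lt.2 (norm_nonneg _))
  have hs : ∀ z ∈ X, 1 + -(z / w) ∈ Complex.slitPlane := fun z hz => by
    apply Complex.mem_slitPlane_of_norm_lt_one
    rw [norm_neg, norm_div, div_lt_one (norm_pos_iff.2 hw0)]
    exact hw z hz
  refine ⟨fun z => Complex.log (-w) + Complex.log (1 + -(z / w)), continuousOn_const.add ?_,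
    fun z hz => ?_⟩
  · exact ContinuousOn.clog (by fun_prop) hs
  · rw [Complex.exp_add, Complex.exp_log (neg_ne_zero.2 hw0),
      Complex.exp_log (Complex.slitPlane_ne_zero (hs z hz))]
    field_simp
    ring

/-- A property of points that propagates from `w` to the points nearer to `w` than `X` is locally
constant off the closed set `X`. -/
theorem exists_ball_forall_iff {X : Set ℂ} (hX : IsClosed X) {P : ℂ → Prop}
    (hP : ∀ w w', P w → (∀ z ∈ X, ‖w' - w‖ < ‖z - w‖) → P w') {w₀ : ℂ} (hw₀ : w₀ ∉ X) :
    ∃ r > 0, Metric.ball w₀ r ⊆ Xᶜ ∧ ∀ w ∈ Metric.ball w₀ r, (P w ↔ P w₀) := by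
  obtain ⟨r, hr, hb⟩ := Metric.isOpen_iff.1 hX.isOpen_compl w₀ hw₀
  have key : ∀ z ∈ X, r ≤ ‖z - w₀‖ := fun z hz => by
    by_contra h
    exact hb (by rw [Metric.mem_ball, dist_eq_norm]; exact not_le.1 h) hz
  refine ⟨r / 2, by positivity, (Metric.ball_subset_ball (by linarith)).trans hb,
    fun w hw => ?_⟩
  rw [Metric.mem_ball, dist_eq_norm] at hw
  constructor
  · intro h
    refine hP w w₀ h fun z hz => ?_
    have h1 := key z hz
    have h2 : ‖z - w₀‖ ≤ ‖z - w‖ + ‖w - w₀‖ := by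
      simpa using norm_add_le (z - w) (w - w₀)
    rw [norm_sub_rev]
    linarith
  · intro h
    refine hP w₀ w h fun z hz => ?_
    have h1 := key z hz
    linarith

/-- By `HasContLog.near`, the points off `K` with a logarithm and those without form two open sets.
The first contains all points far away, so connectedness leaves the second empty. -/
theorem hasContLog_of_isPreconnected_compl {K : Set ℂ} (hK : IsCompact K)
    (hKc : IsPreconnected Kᶜ) {w : ℂ} (hw : w ∉ K) : HasContLog K w := by
  by_contra hcon
  have hP : ∀ w w', HasContLog K w → (∀ z ∈ K, ‖w' - w‖ < ‖z - w‖) → HasContLog K w' :=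
    fun _ _ h h' => h.near h'
  have hopen : ∀ Q : Prop → Prop, IsOpen {w | w ∉ K ∧ Q (HasContLog K w)} := fun Q => by
    rw [Metric.isOpen_iff]
    rintro w₀ ⟨hw₀, hQ⟩
    obtain ⟨r, hr, hb, hiff⟩ := exists_ball_forall_iff hK.isClosed hP hw₀
    exact ⟨r, hr, fun w hw => ⟨hb hw, by rwa [propext (hiff w hw)]⟩⟩
  obtain ⟨R, hR⟩ := hK.isBounded.exists_norm_le
  have hfar : ∀ z ∈ K, ‖z‖ < ‖((|R| + 1 : ℝ) : ℂ)‖ := fun z hz => by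
    rw [Complex.norm_real, Real.norm_of_nonneg (by positivity)]
    linarith [hR z hz, le_abs_self R]
  obtain ⟨x, -, ⟨-, h1⟩, -, h2⟩ := hKc _ _ (hopen id) (hopen Not)
    (fun z hz => by
      by_cases h : HasContLog K z
      · exact Or.inl ⟨hz, h⟩
      · exact Or.inr ⟨hz, h⟩)
    ⟨_, fun h => lt_irrefl _ (hfar _ h), fun h => lt_irrefl _ (hfar _ h), HasContLog.far hfar⟩
    ⟨w, hw, hw, hcon⟩
  exact h2 h1

theorem HasContLog.union {X Y : Set ℂ} (hX : IsClosed X) (hY : IsClosed Y) (hd : Disjoint X Y)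
    {w : ℂ} (h₁ : HasContLog X w) (h₂ : HasContLog Y w) : HasContLog (X ∪ Y) w := by
  classical
  obtain ⟨u, hu, hue⟩ := h₁
  obtain ⟨v, hv, hve⟩ := h₂
  have e₁ : ∀ z ∈ X, X.piecewise u v z = u z := fun z hz => Set.piecewise_eq_of_mem _ _ _ hz
  have e₂ : ∀ z ∈ Y, X.piecewise u v z = v z := fun z hz =>
    Set.piecewise_eq_of_notMem _ _ _ (Set.disjoint_right.1 hd hz)
  refine ⟨X.piecewise u v, (hu.congr e₁).union_of_isClosed (hv.congr e₂) hX hY, ?_⟩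
  rintro z (hz | hz)
  · rw [e₁ z hz, hue z hz]
  · rw [e₂ z hz, hve z hz]

/-- There is no continuous function on `ℂ` that is a logarithm of `z - w` near infinity. -/
theorem not_exists_log_outside {w : ℂ} {R : ℝ} (hR : 0 < R) {v : ℂ → ℂ} (hv : Continuous v)
    (he : ∀ z, R ≤ ‖z - w‖ → Complex.exp (v z) = z - w) : False := by
  -- Along the circle, `exp d` is the constant `R`, so the imaginary part of `d θ - d 0` takes
  -- values in `2πℤ` only. It falls from `0` to `-2π` and would have to pass through `-π`.
  set d : ℝ → ℂ := fun θ => v (circleMap w R θ) - θ * Complex.I with hd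
  have hdc : Continuous d := by fun_prop
  have hexp : ∀ θ, Complex.exp (d θ) = R := fun θ => by
    rw [hd]
    dsimp only
    rw [Complex.exp_sub, he _ (by simp [abs_of_pos hR]), circleMap_sub_center, circleMap_zero,
      mul_div_assoc, div_self (Complex.exp_ne_zero _), mul_one]
  have hint : ∀ θ, ∃ n : ℤ, (d θ - d 0).im = n * (2 * Real.pi) := fun θ => by
    have : Complex.exp (d θ) = Complex.exp (d 0) := by rw [hexp, hexp]
    obtain ⟨n, hn⟩ := Complex.exp_eq_exp_iff_exists_int.1 this
    refine ⟨n, ?_⟩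
    rw [hn]
    simp
  have h2 : d (2 * Real.pi) - d 0 = -(2 * Real.pi * Complex.I) := by
    have : circleMap w R (2 * Real.pi) = circleMap w R 0 := by
      simpa using periodic_circleMap w R 0
    simp only [hd, this]
    push_cast
    ring
  have hiv := intermediate_value_Icc' (f := fun θ => (d θ - d 0).im) (a := 0) (b := 2 * Real.pi)
    Real.two_pi_pos.le (by fun_prop)
  have hmem : (-Real.pi : ℝ) ∈ Set.Icc (d (2 * Real.pi) - d 0).im (d 0 - d 0).im := by
    rw [h2]
    simp only [sub_self, Complex.zero_im, Complex.neg_im, Set.mem_Icc]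
    constructor
    · simp
      linarith [Real.pi_pos]
    · linarith [Real.pi_pos]
  obtain ⟨θ, -, hθ⟩ := hiv hmem
  obtain ⟨n, hn⟩ := hint θ
  dsimp only at hθ
  rw [hn] at hθ
  have h3 : (n : ℝ) * 2 = -1 := by
    have hpi := Real.pi_pos
    have : ((n : ℝ) * 2 + 1) * Real.pi = 0 := by linarith
    rcases mul_eq_zero.1 this with h | h
    · linarith
    · exact absurd h hpi.ne'
  have h4 : n * 2 = -1 := by exact_mod_cast h3
  omega

/-! ### Pole pushing: polynomial approximation of `(z - w)⁻¹` -/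

/-- The function `z ↦ (z - w)⁻¹` is continuous on `X` and a uniform limit of polynomials there. -/
def InvMemPolyClosure (X : Set ℂ) [CompactSpace X] (w : ℂ) : Prop :=
  ∃ f ∈ (polynomialFunctions X).topologicalClosure, ∀ z : X, f z * ((z : ℂ) - w) = 1

section PolyClosure

variable {X : Set ℂ} [CompactSpace X]

/-- The geometric series converges in norm and its partial sums stay in the closed subalgebra. -/
theorem exists_mem_polyClosure_mul_one_sub {f : C(X, ℂ)}
    (hf : f ∈ (polynomialFunctions X).topologicalClosure) (h1 : ∀ z, ‖f z‖ < 1) :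
    ∃ g ∈ (polynomialFunctions X).topologicalClosure, g * (1 - f) = 1 := by
  have hlt : ‖f‖ < 1 := (ContinuousMap.norm_lt_iff f one_pos).2 h1
  refine ⟨∑' n : ℕ, f ^ n, ?_, geom_series_mul_neg f hlt⟩
  have hs := (summable_geometric_of_norm_lt_one hlt).hasSum
  exact (Subalgebra.isClosed_topologicalClosure _).mem_of_tendsto hs
    (Eventually.of_forall fun s => Subalgebra.sum_mem _ fun n _ => Subalgebra.pow_mem _ hf n)

theorem InvMemPolyClosure.near {w w' : ℂ} (h : InvMemPolyClosure X w)
    (hw : ∀ z ∈ X, ‖w' - w‖ < ‖z - w‖) : InvMemPolyClosure X w' := by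
  obtain ⟨f, hf, hfe⟩ := h
  obtain ⟨g, hg, hge⟩ := exists_mem_polyClosure_mul_one_sub (f := (w' - w) • f)
    (Subalgebra.smul_mem _ hf _) fun z => by
      have h1 : ‖f z‖ * ‖(z : ℂ) - w‖ = 1 := by rw [← norm_mul, hfe z, norm_one]
      have h2 := hw z z.2
      rw [ContinuousMap.smul_apply, norm_smul]
      have h3 : 0 < ‖f z‖ := by
        rcases (norm_nonneg (f z)).eq_or_lt with h | h
        · rw [← h, zero_mul] at h1
          exact absurd h1 zero_ne_one
        · exact h
      nlinarith
  refine ⟨g * f, Subalgebra.mul_mem _ hg hf, fun z => ?_⟩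
  have h1 : g z * (1 - (w' - w) * f z) = 1 := by
    simpa using DFunLike.congr_fun hge z
  have h2 := hfe z
  rw [ContinuousMap.mul_apply]
  linear_combination h1 + g z * h2

theorem polynomial_mem_polyClosure (P : ℂ[X]) :
    P.toContinuousMapOn X ∈ (polynomialFunctions X).topologicalClosure :=
  Subalgebra.le_topologicalClosure _ ⟨P, trivial, rfl⟩

theorem InvMemPolyClosure.far {w : ℂ} (hw : ∀ z ∈ X, ‖z‖ < ‖w‖) : InvMemPolyClosure X w := by
  rcases X.eq_empty_or_nonempty with hX | ⟨z₀, hz₀⟩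
  · exact ⟨0, Subalgebra.zero_mem _, fun z => absurd z.2 (by simp [hX])⟩
  have hw0 : w ≠ 0 := fun h => by
    have := hw z₀ hz₀
    rw [h, norm_zero] at this
    exact absurd this (not_lt.2 (norm_nonneg _))
  obtain ⟨g, hg, hge⟩ := exists_mem_polyClosure_mul_one_sub
    (polynomial_mem_polyClosure (X := X) (C w⁻¹ * Polynomial.X)) fun z => by
      have h2 := hw z z.2
      simp only [Polynomial.toContinuousMapOn_apply, Polynomial.toContinuousMap_apply, eval_mul,
        eval_C, eval_X, norm_mul, norm_inv]
      rwa [inv_mul_lt_iff₀ (norm_pos_iff.2 hw0), mul_one]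
  refine ⟨(-w⁻¹) • g, Subalgebra.smul_mem _ hg _, fun z => ?_⟩
  have h1 : g z * (1 - w⁻¹ * z) = 1 := by
    simpa using DFunLike.congr_fun hge z
  rw [ContinuousMap.smul_apply, smul_eq_mul]
  have : w⁻¹ * w = 1 := inv_mul_cancel₀ hw0
  linear_combination h1 + g z * this

/-- If `z - w` has a continuous logarithm on the compact set `X` for all `w ∉ X`, then all
`(z - w)⁻¹`, `w ∉ X`, are uniform limits of polynomials on `X`. -/
theorem invMemPolyClosure_of_hasContLog (hlog : ∀ w ∉ X, HasContLog X w) {w₀ : ℂ}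
    (hw₀ : w₀ ∉ X) : InvMemPolyClosure X w₀ := by
  classical
  by_contra hcon
  have hXc : IsCompact X := isCompact_iff_compactSpace.2 inferInstance
  have hP : ∀ w w', InvMemPolyClosure X w → (∀ z ∈ X, ‖w' - w‖ < ‖z - w‖) →
      InvMemPolyClosure X w' := fun _ _ h h' => h.near h'
  -- The set of bad poles is open, bounded, and has its frontier in `X`: a union of bounded
  -- components of the complement of `X`.
  set V : Set ℂ := {w | w ∉ X ∧ ¬ InvMemPolyClosure X w} with hV
  have hVo : IsOpen V := by
    rw [Metric.isOpen_iff]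
    rintro w₁ ⟨hw₁, hQ⟩
    obtain ⟨r, hr, hb, hiff⟩ := exists_ball_forall_iff hXc.isClosed hP hw₁
    exact ⟨r, hr, fun w hw => ⟨hb hw, by rwa [hiff w hw]⟩⟩
  have hfr : frontier V ⊆ X := by
    intro w hw
    by_contra hwX
    obtain ⟨r, hr, hb, hiff⟩ := exists_ball_forall_iff hXc.isClosed hP hwX
    rw [hVo.frontier_eq] at hw
    obtain ⟨y, hy, hyV⟩ := mem_closure_iff_nhds.1 hw.1 _ (Metric.ball_mem_nhds w hr)
    exact hw.2 ⟨hwX, fun h => hyV.2 ((hiff y hy).2 h)⟩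
  obtain ⟨R, hR⟩ := hXc.isBounded.exists_norm_le
  have hVb : ∀ z ∈ V, ‖z‖ ≤ R := fun z hz => by
    by_contra h
    exact hz.2 (InvMemPolyClosure.far fun x hx => (hR x hx).trans_lt (not_le.1 h))
  obtain ⟨u, hu, hue⟩ := hlog w₀ hw₀
  obtain ⟨U, hU⟩ := ContinuousMap.exists_restrict_eq hXc.isClosed
    (⟨fun z : X => u z, continuousOn_iff_continuous_domRestrict.1 hu⟩ : C(X, ℂ))
  have hUX : ∀ z ∈ X, U z = u z := fun z hz => DFunLike.congr_fun hU ⟨z, hz⟩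
  -- The two pieces agree on the frontier of `V`, as `U` is a logarithm of `z - w₀` on `X`. The only
  -- zero of `z - w₀` lies in `V`, where it has been replaced by an exponential; so `G` has a
  -- logarithm on all of `ℂ`, which is a logarithm of `z - w₀` near infinity.
  set G : ℂ → ℂ := V.piecewise (fun z => Complex.exp (U z)) (fun z => z - w₀) with hG
  have hGc : Continuous G := by
    refine Continuous.piecewise (fun z hz => ?_) (by fun_prop) (by fun_prop)
    rw [hUX z (hfr hz), hue z (hfr hz)]
  have hG0 : ∀ z, G z ≠ 0 := fun z => by
    by_cases hz : z ∈ V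
    · rw [hG, Set.piecewise_eq_of_mem _ _ _ hz]
      exact Complex.exp_ne_zero _
    · rw [hG, Set.piecewise_eq_of_notMem _ _ _ hz, sub_ne_zero]
      rintro rfl
      exact hz ⟨hw₀, hcon⟩
  have hsc : IsSimplyConnected (Set.univ : Set ℂ) :=
    (Homeomorph.Set.univ ℂ).toHomotopyEquiv.simplyConnectedSpace
  obtain ⟨v, hv, hve⟩ := Complex.exists_continuousOn_eqOn_exp_comp hsc isOpen_univ
    hGc.continuousOn (by rintro ⟨z, -, hz⟩; exact hG0 z hz)
  refine not_exists_log_outside (w := w₀) (R := |R| + ‖w₀‖ + 1) (by positivity)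
    (continuousOn_univ.1 hv) fun z hz => ?_
  have hzV : z ∉ V := fun h => by
    have h1 := hVb z h
    have h2 := norm_sub_le z w₀
    linarith [le_abs_self R]
  rw [← Set.piecewise_eq_of_notMem V (fun z => Complex.exp (U z)) (fun z => z - w₀) hzV]
  exact hve (Set.mem_univ z)

end PolyClosure

/-! ### The Cauchy–Pompeiu formula -/

section CauchyPompeiu

open MeasureTheory

/-- Twice the Cauchy–Riemann operator `∂̄`. -/
noncomputable def dbar (φ : ℂ → ℂ) (w : ℂ) : ℂ :=
  fderiv ℝ φ w 1 + Complex.I * fderiv ℝ φ w Complex.I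

theorem dbar_eq_zero_of_differentiableAt {φ : ℂ → ℂ} {w : ℂ} (h : DifferentiableAt ℂ φ w) :
    dbar φ w = 0 := by
  have h1 : fderiv ℝ φ w = (fderiv ℂ φ w).restrictScalars ℝ := h.fderiv_restrictScalars ℝ
  have h2 : fderiv ℂ φ w Complex.I = Complex.I * fderiv ℂ φ w 1 := by
    have := (fderiv ℂ φ w).map_smul Complex.I 1
    rwa [smul_eq_mul, mul_one, smul_eq_mul] at this
  rw [dbar, h1, ContinuousLinearMap.coe_restrictScalars', h2, ← mul_assoc, Complex.I_mul_I]
  ring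

theorem continuous_dbar {φ : ℂ → ℂ} (hφ : ContDiff ℝ 1 φ) : Continuous (dbar φ) := by
  have : Continuous (fderiv ℝ φ) := hφ.continuous_fderiv one_ne_zero
  unfold dbar
  fun_prop

theorem hasCompactSupport_dbar {φ : ℂ → ℂ} (hφ : HasCompactSupport φ) :
    HasCompactSupport (dbar φ) := by
  refine (hφ.fderiv ℝ).mono fun w hw => ?_
  rw [Function.mem_support] at hw ⊢
  intro h
  exact hw (by simp [dbar, h])

/-- In polar coordinates the integrand, times the Jacobian `r`, becomes `∂_r φ + (i / r) ∂_θ φ`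
(`F₁` and `F₂`). The angular term integrates to `0` by periodicity; the radial one gives `-φ 0` in
each direction. -/
theorem integral_dbar_div_self {φ : ℂ → ℂ} (hφ : ContDiff ℝ 1 φ) (hs : HasCompactSupport φ) :
    ∫ w, dbar φ w / w = -(2 * Real.pi) * φ 0 := by
  set e : ℝ → ℂ := fun θ => Real.cos θ + Real.sin θ * Complex.I with he
  have hec : Continuous e := by fun_prop
  have hen : ∀ θ, ‖e θ‖ = 1 := fun θ => by
    rw [he]
    dsimp only
    rw [Complex.ofReal_cos, Complex.ofReal_sin, ← Complex.exp_mul_I,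
      Complex.norm_exp_ofReal_mul_I]
  have he0 : ∀ θ, e θ ≠ 0 := fun θ h => by
    have := hen θ
    rw [h, norm_zero] at this
    exact zero_ne_one this
  have hfc : Continuous (fderiv ℝ φ) := hφ.continuous_fderiv one_ne_zero
  have hd : Differentiable ℝ φ := hφ.differentiable one_ne_zero
  obtain ⟨R, hR⟩ := hs.isCompact.isBounded.exists_norm_le
  have hz : ∀ w, R < ‖w‖ → w ∉ tsupport φ := fun w hw h => absurd (hR w h) (not_le.2 hw)
  have hz1 : ∀ w, R < ‖w‖ → fderiv ℝ φ w = 0 := fun w hw =>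
    image_eq_zero_of_notMem_tsupport fun h => hz w hw (tsupport_fderiv_subset ℝ h)
  have hnorm : ∀ (r : ℝ) θ, ‖(r : ℂ) * e θ‖ = |r| := fun r θ => by
    rw [norm_mul, hen, mul_one, Complex.norm_real, Real.norm_eq_abs]
  set F₁ : ℝ × ℝ → ℂ := fun p => fderiv ℝ φ (p.1 * e p.2) (e p.2) with hF₁
  set F₂ : ℝ × ℝ → ℂ := fun p => Complex.I * fderiv ℝ φ (p.1 * e p.2) (Complex.I * e p.2)
    with hF₂
  have hint : ∀ F : ℝ × ℝ → ℂ, Continuous F → (∀ p : ℝ × ℝ, R < |p.1| → F p = 0) →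
      IntegrableOn F polarCoord.target := fun F hF hF0 => by
    have h1 : IntegrableOn F (Set.Icc 0 R ×ˢ Set.Icc (-Real.pi) Real.pi) :=
      hF.continuousOn.integrableOn_compact (isCompact_Icc.prod isCompact_Icc)
    refine h1.of_forall_sdiff_eq_zero polarCoord.open_target.measurableSet fun p hp => ?_
    rw [polarCoord_target] at hp
    obtain ⟨⟨hp1, hp2⟩, hp3⟩ := hp
    have hp1' : 0 < p.1 := hp1
    refine hF0 p ?_
    by_contra h
    rw [abs_of_pos hp1', not_lt] at h
    exact hp3 ⟨⟨hp1'.le, h⟩, ⟨hp2.1.le, hp2.2.le⟩⟩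
  have hI₁ : IntegrableOn F₁ polarCoord.target := hint _ (by fun_prop) fun p hp => by
    simp only [hF₁]
    rw [hz1 _ (by rwa [hnorm])]
    rfl
  have hI₂ : IntegrableOn F₂ polarCoord.target := hint _ (by fun_prop) fun p hp => by
    simp only [hF₂]
    rw [hz1 _ (by rwa [hnorm])]
    simp
  have hpolar : ∫ w, dbar φ w / w = ∫ p in polarCoord.target, (F₁ p + F₂ p) := by
    rw [← Complex.integral_comp_polarCoord_symm]
    refine setIntegral_congr_fun polarCoord.open_target.measurableSet fun p hp => ?_
    rw [polarCoord_target] at hp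
    have hp1 : (p.1 : ℂ) ≠ 0 := by exact_mod_cast (show 0 < p.1 from hp.1).ne'
    rw [Complex.polarCoord_symm_apply, Complex.real_smul]
    change (p.1 : ℂ) * (dbar φ (p.1 * e p.2) / (p.1 * e p.2)) = _
    have hlin : ∀ (T : ℂ →L[ℝ] ℂ) (a b : ℝ), T (a + b * Complex.I) = a * T 1 + b * T Complex.I :=
      fun T a b => by
        have : (a + b * Complex.I : ℂ) = a • (1 : ℂ) + b • Complex.I := by simp
        rw [this, map_add, map_smul, map_smul, Complex.real_smul, Complex.real_smul]
    have h1 : e p.2 * (Real.cos p.2 - Real.sin p.2 * Complex.I) = 1 := by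
      have := Complex.cos_sq_add_sin_sq p.2
      rw [he]
      push_cast
      linear_combination this - Complex.sin p.2 ^ 2 * Complex.I_sq
    have h2 : Complex.I * e p.2 = ((-Real.sin p.2 : ℝ) : ℂ) + (Real.cos p.2 : ℝ) * Complex.I := by
      rw [he]
      push_cast
      linear_combination Complex.sin p.2 * Complex.I_sq
    simp only [hF₁, hF₂]
    rw [h2]
    set T := fderiv ℝ φ (p.1 * e p.2) with hT
    have h3 : T (e p.2) = Real.cos p.2 * T 1 + Real.sin p.2 * T Complex.I := hlin T _ _
    rw [h3, hlin]
    rw [mul_div_assoc', mul_div_mul_left _ _ hp1, div_eq_iff (he0 p.2)]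
    simp only [dbar, ← hT]
    push_cast at h1 ⊢
    linear_combination (-(T 1) - Complex.I * T Complex.I) * h1 -
      (Complex.sin p.2 * T Complex.I * e p.2) * Complex.I_sq
  have hmeas : (volume : Measure (ℝ × ℝ)).restrict polarCoord.target =
      (volume.restrict (Set.Ioi (0 : ℝ))).prod
        (volume.restrict (Set.Ioo (-Real.pi) Real.pi)) := by
    rw [polarCoord_target, Measure.prod_restrict]
    rfl
  rw [hpolar, integral_add hI₁ hI₂]
  unfold IntegrableOn at hI₁ hI₂
  rw [hmeas] at hI₁ hI₂ ⊢
  have hder : ∀ r θ : ℝ, HasDerivAt (fun θ : ℝ => φ (r * e θ))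
      (fderiv ℝ φ (r * e θ) (r * (Complex.I * e θ))) θ := fun r θ => by
    have h1 : HasDerivAt e (Complex.I * e θ) θ := by
      have hc := (Real.hasDerivAt_cos θ).ofReal_comp
      have hsn := ((Real.hasDerivAt_sin θ).ofReal_comp).mul_const Complex.I
      convert! hc.add hsn using 1
      rw [he]
      push_cast
      linear_combination Complex.sin θ * Complex.I_sq
    exact (hd _).hasFDerivAt.comp_hasDerivAt θ (h1.const_mul (r : ℂ))
  have hJ₂ : ∫ p, F₂ p ∂((volume.restrict (Set.Ioi (0 : ℝ))).prod
        (volume.restrict (Set.Ioo (-Real.pi) Real.pi))) = 0 := by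
    rw [integral_prod _ hI₂]
    refine setIntegral_eq_zero_of_forall_eq_zero fun r hr => ?_
    have hr0 : (r : ℂ) ≠ 0 := by exact_mod_cast (show 0 < r from hr).ne'
    have hle : -Real.pi ≤ Real.pi := by linarith [Real.pi_pos]
    rw [← integral_Ioc_eq_integral_Ioo, ← intervalIntegral.integral_of_le hle]
    have h1 := intervalIntegral.integral_eq_sub_of_hasDerivAt (a := -Real.pi) (b := Real.pi)
      (fun θ _ => hder r θ) (Continuous.intervalIntegrable (by fun_prop) _ _)
    have h2 : e Real.pi = e (-Real.pi) := by simp [he]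
    rw [h2, sub_self] at h1
    have h3 : ∀ θ, F₂ (r, θ) = Complex.I * (r : ℂ)⁻¹ *
        fderiv ℝ φ (r * e θ) (r * (Complex.I * e θ)) := fun θ => by
      simp only [hF₂]
      have := (fderiv ℝ φ (r * e θ)).map_smul r (Complex.I * e θ)
      rw [Complex.real_smul, Complex.real_smul] at this
      rw [this]
      field_simp
    simp only [h3]
    rw [intervalIntegral.integral_const_mul, h1, mul_zero]
  have hJ₁ : ∫ p, F₁ p ∂((volume.restrict (Set.Ioi (0 : ℝ))).prod
        (volume.restrict (Set.Ioo (-Real.pi) Real.pi))) = -(2 * Real.pi) * φ 0 := by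
    rw [integral_prod_symm _ hI₁]
    have hinner : ∀ θ, ∫ r in Set.Ioi (0 : ℝ), F₁ (r, θ) = -φ 0 := fun θ => by
      have hcs : HasCompactSupport fun r : ℝ => φ (r * e θ) := by
        refine HasCompactSupport.intro (isCompact_Icc (a := -R) (b := R)) fun r hr => ?_
        refine image_eq_zero_of_notMem_tsupport (hz _ ?_)
        rw [hnorm]
        by_contra h
        exact hr (abs_le.1 (not_lt.1 h))
      have hcd : ContDiff ℝ 1 fun r : ℝ => φ (r * e θ) :=
        hφ.comp (Complex.ofRealCLM.contDiff.mul contDiff_const)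
      have h1 := hcs.integral_Ioi_deriv_eq hcd 0
      have h2 : ∀ r : ℝ, deriv (fun r : ℝ => φ (r * e θ)) r = F₁ (r, θ) := fun r => by
        have h3 : HasDerivAt (fun r : ℝ => (r : ℂ) * e θ) (e θ) r := by
          simpa using (Complex.ofRealCLM.hasDerivAt (x := r)).mul_const (e θ)
        exact ((hd _).hasFDerivAt.comp_hasDerivAt r h3).deriv
      simpa [h2] using h1
    simp only [hinner]
    rw [setIntegral_const, Real.volume_real_Ioo_of_le (by linarith [Real.pi_pos]),
      Complex.real_smul]
    push_cast
    ring
  rw [hJ₁, hJ₂, add_zero]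

/-- The Cauchy–Pompeiu formula for a compactly supported function. -/
theorem integral_dbar_div_sub {φ : ℂ → ℂ} (hφ : ContDiff ℝ 1 φ) (hs : HasCompactSupport φ)
    (z : ℂ) : ∫ w, dbar φ w / (w - z) = -(2 * Real.pi) * φ z := by
  have h := integral_dbar_div_self (φ := fun w => φ (w + z)) (hφ.comp (by fun_prop))
    (hs.comp_homeomorph (Homeomorph.addRight z))
  have hd : ∀ w, dbar (fun w => φ (w + z)) w = dbar φ (w + z) := fun w => by
    simp only [dbar, fderiv_comp_add_right]
  rw [zero_add] at h
  rw [← h, ← integral_add_right_eq_self _ z]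
  simp only [hd, add_sub_cancel_right]

end CauchyPompeiu

/-! ### Runge's theorem and exhaustion of `Ω` -/

section Runge

open MeasureTheory

/-- Cauchy–Pompeiu writes `φ` on `X` as an integral of multiples of `(w - z)⁻¹` over `w` off `X`.
Read as a `C(X, ℂ)`-valued integral, it stays in the closed span of its integrand. -/
theorem exists_mem_polyClosure_eq_of_dbar {X : Set ℂ} [CompactSpace X]
    (hX : ∀ w ∉ X, InvMemPolyClosure X w) {φ : ℂ → ℂ} (hφ : ContDiff ℝ 1 φ)
    (hs : HasCompactSupport φ) (hd : ∀ z ∈ X, ∀ᶠ w in 𝓝 z, dbar φ w = 0) :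
    ∃ f ∈ (polynomialFunctions X).topologicalClosure, ∀ z : X, f z = φ z := by
  set A := (polynomialFunctions X).topologicalClosure with hA
  -- On the diagonal the quotient is `0 / 0 = 0`, consistent with `dbar φ` vanishing near each point
  -- of `X`.
  have hker : Continuous fun p : ℂ × X => dbar φ p.1 / (p.1 - p.2) := by
    rw [continuous_iff_continuousAt]
    rintro ⟨w, x⟩
    by_cases hwx : w = x
    · subst hwx
      have h1 : ∀ᶠ p : ℂ × X in 𝓝 ((x : ℂ), x), dbar φ p.1 / (p.1 - p.2) = 0 := by
        have := (continuous_fst (X := ℂ) (Y := X)).continuousAt (x := ((x : ℂ), x))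
          |>.eventually (hd x x.2)
        filter_upwards [this] with p hp
        rw [hp, zero_div]
      exact continuousAt_const.congr (h1.mono fun p hp => hp.symm)
    · refine ContinuousAt.div ?_ (by fun_prop) (sub_ne_zero.2 hwx)
      exact ((continuous_dbar hφ).comp continuous_fst).continuousAt
  set Ψ : ℂ → C(X, ℂ) := fun w => ⟨fun x => dbar φ w / (w - x),
    hker.comp (continuous_const.prodMk continuous_id)⟩ with hΨ
  have hΨc : Continuous Ψ := ContinuousMap.continuous_of_continuous_uncurry _ hker
  have hΨA : ∀ w, Ψ w ∈ A := fun w => by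
    by_cases hw : w ∈ X
    · have : Ψ w = 0 := by
        ext x
        simp [hΨ, (hd w hw).self_of_nhds]
      rw [this]
      exact Subalgebra.zero_mem _
    · obtain ⟨f, hf, hfe⟩ := hX w hw
      have : Ψ w = (-dbar φ w) • f := by
        ext x
        have hne : w - x ≠ 0 := sub_ne_zero.2 fun h => hw (h ▸ x.2)
        simp only [hΨ, ContinuousMap.coe_mk, ContinuousMap.smul_apply, smul_eq_mul]
        rw [div_eq_iff hne]
        linear_combination (-dbar φ w) * hfe x
      rw [this]
      exact Subalgebra.smul_mem _ hf _
  have hΨs : HasCompactSupport Ψ := by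
    refine (hasCompactSupport_dbar hs).mono fun w hw => ?_
    rw [Function.mem_support] at hw ⊢
    intro h
    exact hw (by ext x; simp [hΨ, h])
  have hint : Integrable Ψ := hΨc.integrable_of_hasCompactSupport hΨs
  have hmem : ∫ w, Ψ w ∈ A := by
    -- Integrating inside the closed, hence complete, submodule places the value there.
    let S : Submodule ℂ C(X, ℂ) := Subalgebra.toSubmodule A
    have hSc : IsClosed (S : Set C(X, ℂ)) := Subalgebra.isClosed_topologicalClosure _
    have : CompleteSpace S := hSc.completeSpace_coe
    set Θ : ℂ → S := fun w => ⟨Ψ w, hΨA w⟩ with hΘ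
    have hΘc : Continuous Θ := hΨc.subtype_mk _
    have hΘs : HasCompactSupport Θ := by
      refine hΨs.mono fun w hw => ?_
      rw [Function.mem_support] at hw ⊢
      intro h
      exact hw (Subtype.ext h)
    have hΘi : Integrable Θ := hΘc.integrable_of_hasCompactSupport hΘs
    have h1 := (S.subtypeL).integral_comp_comm hΘi
    have h2 : ∫ w, Ψ w = S.subtypeL (∫ w, Θ w) := h1
    rw [h2]
    exact (∫ w, Θ w).2
  refine ⟨(-(2 * Real.pi : ℂ))⁻¹ • ∫ w, Ψ w, Subalgebra.smul_mem _ hmem _, fun z => ?_⟩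
  rw [ContinuousMap.smul_apply, ContinuousMap.integral_apply hint]
  have h1 : ∫ w, Ψ w z = -(2 * Real.pi) * φ z := integral_dbar_div_sub hφ hs z
  have h2 : (-(2 * Real.pi : ℂ)) ≠ 0 := by
    simp
  rw [h1, smul_eq_mul, inv_mul_cancel_left₀ h2]

/-- A smooth cut-off glues `g` near `L` to `0` off `Ω`. Holomorphy is lost only in between, away
from the compacts to be approximated on. -/
theorem exists_cutoff_mul {Ω L : Set ℂ} (hΩ : IsOpen Ω) (hL : IsCompact L) (hLΩ : L ⊆ Ω)
    {g : ℂ → ℂ} (hg : DifferentiableOn ℂ g Ω) :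
    ∃ φ : ℂ → ℂ, ContDiff ℝ 1 φ ∧ HasCompactSupport φ ∧ (∀ z ∈ L, φ =ᶠ[𝓝 z] g) ∧
      ∀ z ∉ Ω, φ =ᶠ[𝓝 z] 0 := by
  obtain ⟨M, hM, hLM, hMΩ⟩ := exists_compact_between hL hΩ hLΩ
  obtain ⟨χ, hχ1, hχ0, -⟩ := exists_contMDiffMap_one_nhds_of_subset_interior
    (modelWithCornersSelf ℝ ℂ) (n := 1) hL.isClosed hLM
  have hχ : ContDiff ℝ 1 χ := contMDiff_iff_contDiff.1 χ.contMDiff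
  have hoff : ∀ z ∉ M, (fun z => (χ z : ℂ) * g z) =ᶠ[𝓝 z] 0 := fun z hz => by
    filter_upwards [hM.isClosed.isOpen_compl.mem_nhds hz] with w hw
    simp [hχ0 w hw]
  refine ⟨fun z => χ z * g z, ?_, ?_, fun z hz => ?_, fun z hz => hoff z fun h => hz (hMΩ h)⟩
  · rw [contDiff_iff_contDiffAt]
    intro z
    by_cases hz : z ∈ Ω
    · have h1 : ContDiffAt ℝ 1 g z :=
        ((hg.analyticAt (hΩ.mem_nhds hz)).contDiffAt (n := 1)).restrict_scalars ℝ
      exact ((Complex.ofRealCLM.contDiff.comp hχ).contDiffAt).mul h1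
    · exact contDiffAt_const.congr_of_eventuallyEq (hoff z fun h => hz (hMΩ h))
  · exact HasCompactSupport.intro hM fun z hz => (hoff z hz).self_of_nhds
  · filter_upwards [(eventually_nhdsSet_iff_forall.1 hχ1) z hz] with w hw
    simp [hw]

/-- Runge's theorem, for a function that vanishes near a part of the compact set. -/
theorem exists_polynomial_near_of_hasContLog {Ω L K : Set ℂ} (hΩ : IsOpen Ω) (hL : IsCompact L)
    (hLΩ : L ⊆ Ω) (hK : IsCompact K) (hKΩ : K ⊆ Ωᶜ)
    (hlog : ∀ w ∉ L ∪ K, HasContLog (L ∪ K) w) {g : ℂ → ℂ} (hg : DifferentiableOn ℂ g Ω)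
    {ε : ℝ} (hε : 0 < ε) :
    ∃ P : ℂ[X], (∀ z ∈ L, ‖P.eval z - g z‖ < ε) ∧ ∀ z ∈ K, ‖P.eval z‖ < ε := by
  have : CompactSpace (L ∪ K : Set ℂ) := isCompact_iff_compactSpace.1 (hL.union hK)
  obtain ⟨φ, hφ, hs, hφL, hφK⟩ := exists_cutoff_mul hΩ hL hLΩ hg
  have hd : ∀ z ∈ L ∪ K, ∀ᶠ w in 𝓝 z, dbar φ w = 0 := by
    rintro z (hz | hz)
    · filter_upwards [(hφL z hz).eventually_nhds, hΩ.mem_nhds (hLΩ hz)] with w hw hwΩ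
      exact dbar_eq_zero_of_differentiableAt
        (((hg w hwΩ).differentiableAt (hΩ.mem_nhds hwΩ)).congr_of_eventuallyEq hw)
    · filter_upwards [(hφK z (hKΩ hz)).eventually_nhds] with w hw
      exact dbar_eq_zero_of_differentiableAt
        ((differentiableAt_const 0).congr_of_eventuallyEq hw)
  obtain ⟨f, hf, hfe⟩ := exists_mem_polyClosure_eq_of_dbar
    (fun w hw => invMemPolyClosure_of_hasContLog hlog hw) hφ hs hd
  have hf' : f ∈ closure (polynomialFunctions (L ∪ K) : Set C((L ∪ K : Set ℂ), ℂ)) := hf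
  obtain ⟨_, ⟨P, -, rfl⟩, hP⟩ := Metric.mem_closure_iff.1 hf' ε hε
  have key : ∀ z ∈ L ∪ K, ‖P.eval z - φ z‖ < ε := fun z hz => by
    rw [dist_comm] at hP
    have := (ContinuousMap.dist_apply_le_dist (⟨z, hz⟩ : (L ∪ K : Set ℂ))).trans_lt hP
    rwa [dist_eq_norm, hfe] at this
  refine ⟨P, fun z hz => ?_, fun z hz => ?_⟩
  · rw [← (hφL z hz).self_of_nhds]
    exact key z (Or.inl hz)
  · have := key z (Or.inr hz)
    rwa [(hφK z (hKΩ hz)).self_of_nhds, Pi.zero_apply, sub_zero] at this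

/-- An exhaustion of `Ω` by compact sets. -/
def innerCompact (Ω : Set ℂ) (n : ℕ) : Set ℂ :=
  Metric.closedBall 0 n \ Metric.thickening (1 / ((n : ℝ) + 1)) Ωᶜ

theorem isCompact_innerCompact (Ω : Set ℂ) (n : ℕ) : IsCompact (innerCompact Ω n) :=
  (isCompact_closedBall 0 _).diff Metric.isOpen_thickening

theorem innerCompact_subset (Ω : Set ℂ) (n : ℕ) : innerCompact Ω n ⊆ Ω := fun z hz => by
  by_contra h
  exact hz.2 (Metric.self_subset_thickening (by positivity) _ h)

theorem eventually_subset_innerCompact {Ω L : Set ℂ} (hΩ : IsOpen Ω) (hL : IsCompact L)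
    (hLΩ : L ⊆ Ω) : ∀ᶠ n in atTop, L ⊆ innerCompact Ω n := by
  obtain ⟨R, hR⟩ := hL.isBounded.exists_norm_le
  obtain ⟨δ, hδ, hd⟩ := (Set.disjoint_compl_right_iff_subset.2 hLΩ).exists_thickenings hL
    hΩ.isClosed_compl
  filter_upwards [(tendsto_natCast_atTop_atTop (R := ℝ)).eventually_ge_atTop R,
    tendsto_one_div_add_atTop_nhds_zero_nat.eventually_lt_const hδ] with n hn hn' z hz
  refine ⟨mem_closedBall_zero_iff.2 ((hR z hz).trans hn), fun h => ?_⟩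
  exact Set.disjoint_left.1 hd (Metric.self_subset_thickening hδ _ hz)
    (Metric.thickening_mono hn'.le _ h)

/-- A point `w` off the compact is either beyond the large disc, or within `1 / (n + 1)` of some `w₁
∉ Ω`. Simple connectedness gives a logarithm for `w₁`, and `w` is nearer to `w₁` than the compact
is. -/
theorem hasContLog_innerCompact {Ω : Set ℂ} (hΩ : IsOpen Ω) (hΩs : IsSimplyConnected Ω) (n : ℕ)
    {w : ℂ} (hw : w ∉ innerCompact Ω n) : HasContLog (innerCompact Ω n) w := by
  by_cases hwn : w ∈ Metric.closedBall (0 : ℂ) n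
  · have h1 : w ∈ Metric.thickening (1 / ((n : ℝ) + 1)) Ωᶜ := by
      by_contra h
      exact hw ⟨hwn, h⟩
    obtain ⟨w₁, hw₁, hd⟩ := Metric.mem_thickening_iff.1 h1
    obtain ⟨u, hu, hue⟩ := Complex.exists_continuousOn_eqOn_exp_comp hΩs hΩ
      (g := fun z => z - w₁) (by fun_prop) (by
        rintro ⟨z, hz, h0⟩
        rw [sub_eq_zero.1 h0] at hz
        exact hw₁ hz)
    have h2 : HasContLog (innerCompact Ω n) w₁ :=
      ⟨u, hu.mono (innerCompact_subset Ω n), fun z hz => hue (innerCompact_subset Ω n hz)⟩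
    refine h2.near fun z hz => ?_
    rw [dist_eq_norm] at hd
    refine hd.trans_le ?_
    by_contra h
    refine hz.2 (Metric.mem_thickening_iff.2 ⟨w₁, hw₁, ?_⟩)
    rw [dist_eq_norm]
    exact not_le.1 h
  · refine HasContLog.far fun z hz => ?_
    rw [mem_closedBall_zero_iff, not_le] at hwn
    exact (mem_closedBall_zero_iff.1 hz.1).trans_lt hwn

/-- Runge is applied to `g - h` near `Ω` and `0` near `K`; then `h` is added back. -/
theorem exists_polynomial_near {Ω K : Set ℂ} (hΩ : IsOpen Ω) (hΩs : IsSimplyConnected Ω)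
    (hK : IsCompact K) (hKΩ : K ⊆ Ωᶜ) (hKc : IsPreconnected Kᶜ) (n : ℕ) {g : ℂ → ℂ}
    (hg : DifferentiableOn ℂ g Ω) (h : ℂ[X]) {ε : ℝ} (hε : 0 < ε) :
    ∃ P : ℂ[X], (∀ z ∈ innerCompact Ω n, ‖P.eval z - g z‖ < ε) ∧
      ∀ z ∈ K, ‖P.eval z - h.eval z‖ < ε := by
  have hd : Disjoint (innerCompact Ω n) K :=
    Set.disjoint_left.2 fun z hz hz' => hKΩ hz' (innerCompact_subset Ω n hz)
  obtain ⟨P, hP₁, hP₂⟩ := exists_polynomial_near_of_hasContLog hΩ (isCompact_innerCompact Ω n)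
    (innerCompact_subset Ω n) hK hKΩ (fun w hw =>
      (hasContLog_innerCompact hΩ hΩs n fun h => hw (Or.inl h)).union
        (isCompact_innerCompact Ω n).isClosed hK.isClosed hd
        (hasContLog_of_isPreconnected_compl hK hKc fun h => hw (Or.inr h)))
    (hg.sub (h.differentiable.differentiableOn)) hε
  refine ⟨P + h, fun z hz => ?_, fun z hz => ?_⟩
  · have := hP₁ z hz
    rw [eval_add]
    convert! this using 2
    simp only [Pi.sub_apply]
    ring
  · simpa using hP₂ z hz

end Runge

/-! ### Padé approximants: algebra and continuous dependence -/

section Pade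

/-- The linearised Padé equations for `A / B`, in the variable `z - ζ`. -/
def IsPadePair (a : PowerSeries ℂ) (ζ : ℂ) (p q : ℕ) (A B : ℂ[X]) : Prop :=
  A.natDegree ≤ p ∧ B.natDegree ≤ q ∧ B.eval ζ = 1 ∧
    (PowerSeries.X : PowerSeries ℂ) ^ (p + q + 1) ∣
      (taylor ζ B : PowerSeries ℂ) * a - (taylor ζ A : PowerSeries ℂ)

/-- The series of `B` is a unit because `B(ζ) = 1`, so multiplying by it does not change the order
of contact. -/
theorem isPadeApproximant_iff {a : PowerSeries ℂ} {ζ : ℂ} {p q : ℕ} {Φ : RatFunc ℂ} :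
    IsPadeApproximant a ζ p q Φ ↔ ∃ A B : ℂ[X], IsPadePair a ζ p q A B ∧
      Φ = algebraMap ℂ[X] (RatFunc ℂ) A / algebraMap ℂ[X] (RatFunc ℂ) B := by
  have key : ∀ A B : ℂ[X], B.eval ζ = 1 →
      ((∀ ν ≤ p + q, PowerSeries.coeff ν (ratTaylorSeries A B ζ) = PowerSeries.coeff ν a) ↔
      (PowerSeries.X : PowerSeries ℂ) ^ (p + q + 1) ∣
        (taylor ζ B : PowerSeries ℂ) * a - (taylor ζ A : PowerSeries ℂ)) := by
    intro A B hB
    have hc : PowerSeries.constantCoeff (taylor ζ B : PowerSeries ℂ) ≠ 0 := by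
      rw [← PowerSeries.coeff_zero_eq_constantCoeff_apply, Polynomial.coeff_coe,
        Polynomial.taylor_coeff_zero, hB]
      exact one_ne_zero
    have hu : IsUnit (taylor ζ B : PowerSeries ℂ) :=
      PowerSeries.isUnit_iff_constantCoeff.2 (isUnit_iff_ne_zero.2 hc)
    have h1 : (taylor ζ B : PowerSeries ℂ) * a - (taylor ζ A : PowerSeries ℂ) =
        (taylor ζ B : PowerSeries ℂ) * (a - ratTaylorSeries A B ζ) := by
      rw [mul_sub, ratTaylorSeries, mul_left_comm, PowerSeries.mul_inv_cancel _ hc, mul_one]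
    rw [h1, hu.dvd_mul_left, PowerSeries.X_pow_dvd_iff]
    refine forall_congr' fun ν => ?_
    rw [map_sub, sub_eq_zero, eq_comm, Nat.lt_succ_iff]
  constructor
  · rintro ⟨A, B, hA, hB, hB1, hΦ, h⟩
    exact ⟨A, B, ⟨hA, hB, hB1, (key A B hB1).1 h⟩, hΦ⟩
  · rintro ⟨A, B, ⟨hA, hB, hB1, h⟩, hΦ⟩
    exact ⟨A, B, hA, hB, hB1, hΦ, (key A B hB1).2 h⟩

theorem coeff_coe_mul_eq_sum_intCoeff (B : ℂ[X]) (a : PowerSeries ℂ) {q : ℕ}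
    (hB : B.natDegree ≤ q) (n : ℕ) :
    PowerSeries.coeff n ((B : PowerSeries ℂ) * a) =
      ∑ k ∈ Finset.range (q + 1), B.coeff k * intCoeff a ((n : ℤ) - k) := by
  rw [PowerSeries.coeff_mul, Finset.Nat.sum_antidiagonal_eq_sum_range_succ
    (fun i j => PowerSeries.coeff i (B : PowerSeries ℂ) * PowerSeries.coeff j a)]
  have h1 : ∀ k ∈ Finset.range (n + 1), PowerSeries.coeff k (B : PowerSeries ℂ) *
      PowerSeries.coeff (n - k) a = B.coeff k * intCoeff a ((n : ℤ) - k) := fun k hk => by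
    have hk' : k ≤ n := by
      rw [Finset.mem_range] at hk
      omega
    rw [Polynomial.coeff_coe, intCoeff, if_pos (by omega)]
    congr 3
    omega
  rw [Finset.sum_congr rfl h1]
  have h2 : Finset.range (n + 1) ⊆ Finset.range (n + q + 1) :=
    Finset.range_subset_range.2 (by omega)
  have h3 : Finset.range (q + 1) ⊆ Finset.range (n + q + 1) :=
    Finset.range_subset_range.2 (by omega)
  rw [Finset.sum_subset h2, Finset.sum_subset h3]
  · intro k _ hk
    rw [Finset.mem_range] at hk
    rw [Polynomial.coeff_eq_zero_of_natDegree_lt (by omega), zero_mul]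
  · intro k _ hk
    rw [Finset.mem_range] at hk
    rw [intCoeff, if_neg (by omega), mul_zero]

theorem coeff_coe_mul_eq_hankel_mulVec (B : ℂ[X]) (a : PowerSeries ℂ) {q : ℕ}
    (hB : B.natDegree ≤ q) (hB0 : B.coeff 0 = 1) (p : ℕ) (i : Fin q) :
    PowerSeries.coeff (p + 1 + i) ((B : PowerSeries ℂ) * a) =
      PowerSeries.coeff (p + 1 + i) a +
        (hankelMatrix a p q).mulVec (fun j => B.coeff (q - j)) i := by
  rw [coeff_coe_mul_eq_sum_intCoeff B a hB, Finset.sum_range_succ',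
    add_comm (PowerSeries.coeff _ a), hB0, one_mul]
  congr 1
  · rw [Matrix.mulVec, dotProduct, Finset.sum_fin_eq_sum_range, ← Finset.sum_range_reflect]
    refine Finset.sum_congr rfl fun j hj => ?_
    rw [Finset.mem_range] at hj
    rw [dif_pos hj, mul_comm, hankelMatrix, Matrix.of_apply]
    have h1 : q - 1 - j + 1 = q - j := by omega
    rw [h1]
    congr 2
    push_cast [Nat.cast_sub hj.le]
    ring

theorem IsPadePair.hankel_mulVec {a : PowerSeries ℂ} {ζ : ℂ} {p q : ℕ} {A B : ℂ[X]}
    (h : IsPadePair a ζ p q A B) (i : Fin q) :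
    (hankelMatrix a p q).mulVec (fun j => (taylor ζ B).coeff (q - j)) i =
      -PowerSeries.coeff (p + 1 + i) a := by
  obtain ⟨hA, hB, hB1, hd⟩ := h
  have h1 := PowerSeries.X_pow_dvd_iff.1 hd (p + 1 + i) (by omega)
  rw [map_sub, coeff_coe_mul_eq_hankel_mulVec _ _ (by rwa [natDegree_taylor])
    (by rwa [taylor_coeff_zero]), Polynomial.coeff_coe,
    Polynomial.coeff_eq_zero_of_natDegree_lt (p := taylor ζ A)
      (by rw [natDegree_taylor]; omega)] at h1
  linear_combination h1

/-- The coefficients of `B` solve a linear system with the invertible Hankel matrix; `A` is then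
read off from the low orders of `B * a`. -/
theorem IsPadePair.unique {a : PowerSeries ℂ} {ζ : ℂ} {p q : ℕ} {A B A' B' : ℂ[X]}
    (hD : MemPadeD a p q) (h : IsPadePair a ζ p q A B) (h' : IsPadePair a ζ p q A' B') :
    A = A' ∧ B = B' := by
  have hvec : (fun j : Fin q => (taylor ζ B).coeff (q - j)) =
      fun j : Fin q => (taylor ζ B').coeff (q - j) := by
    refine Matrix.mulVec_injective_of_isUnit
      ((Matrix.isUnit_iff_isUnit_det _).2 (isUnit_iff_ne_zero.2 hD)) ?_
    ext i
    rw [h.hankel_mulVec, h'.hankel_mulVec]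
  have hB : B = B' := by
    refine taylor_injective ζ (Polynomial.ext fun k => ?_)
    rcases Nat.eq_zero_or_pos k with rfl | hk
    · rw [taylor_coeff_zero, taylor_coeff_zero, h.2.2.1, h'.2.2.1]
    rcases le_or_gt k q with hkq | hkq
    · have := congr_fun hvec ⟨q - k, by omega⟩
      simpa [Nat.sub_sub_self hkq] using this
    · rw [Polynomial.coeff_eq_zero_of_natDegree_lt, Polynomial.coeff_eq_zero_of_natDegree_lt] <;>
        rw [natDegree_taylor]
      · exact h'.2.1.trans_lt hkq
      · exact h.2.1.trans_lt hkq
  refine ⟨taylor_injective ζ (Polynomial.ext fun k => ?_), hB⟩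
  rcases le_or_gt k p with hkp | hkp
  · have h1 := PowerSeries.X_pow_dvd_iff.1 h.2.2.2 k (by omega)
    have h2 := PowerSeries.X_pow_dvd_iff.1 h'.2.2.2 k (by omega)
    rw [map_sub, Polynomial.coeff_coe] at h1 h2
    rw [hB] at h1
    linear_combination h2 - h1
  · rw [Polynomial.coeff_eq_zero_of_natDegree_lt, Polynomial.coeff_eq_zero_of_natDegree_lt] <;>
      rw [natDegree_taylor]
    · exact h'.1.trans_lt hkp
    · exact h.1.trans_lt hkp

/-- If `A` and `B` had a common root `z`, replacing the factor `X - z` by its value `ζ - z` at `ζ`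
in both would keep the normalisation and give a second Padé pair. -/
theorem IsPadePair.eval_ne_zero {a : PowerSeries ℂ} {ζ : ℂ} {p q : ℕ} {A B : ℂ[X]}
    (hD : MemPadeD a p q) (h : IsPadePair a ζ p q A B) {z : ℂ} (hBz : B.eval z = 0) :
    A.eval z ≠ 0 := by
  intro hAz
  obtain ⟨A₁, rfl⟩ := dvd_iff_isRoot.2 hAz
  obtain ⟨B₁, rfl⟩ := dvd_iff_isRoot.2 hBz
  have hz : ζ - z ≠ 0 := by
    intro h0
    have := h.2.2.1
    rw [eval_mul, eval_sub, eval_X, eval_C, h0, zero_mul] at this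
    exact zero_ne_one this
  have hdeg : ∀ (P : ℂ[X]) (n : ℕ), ((X - C z) * P).natDegree ≤ n →
      (C (ζ - z) * P).natDegree ≤ n := fun P n hn => by
    rcases eq_or_ne P 0 with rfl | hP
    · simp
    rw [natDegree_mul (X_sub_C_ne_zero z) hP, natDegree_X_sub_C] at hn
    exact (natDegree_C_mul_le _ _).trans (by omega)
  have h' : IsPadePair a ζ p q (C (ζ - z) * A₁) (C (ζ - z) * B₁) := by
    refine ⟨hdeg _ _ h.1, hdeg _ _ h.2.1, by simpa using h.2.2.1, ?_⟩
    have hd := h.2.2.2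
    have hu : IsUnit (taylor ζ (X - C z) : PowerSeries ℂ) := by
      refine PowerSeries.isUnit_iff_constantCoeff.2 (isUnit_iff_ne_zero.2 ?_)
      rw [← PowerSeries.coeff_zero_eq_constantCoeff_apply, Polynomial.coeff_coe,
        Polynomial.taylor_coeff_zero]
      simpa using hz
    have h1 : ((taylor ζ ((X - C z) * B₁) : ℂ[X]) : PowerSeries ℂ) * a -
        ((taylor ζ ((X - C z) * A₁) : ℂ[X]) : PowerSeries ℂ) =
        ((taylor ζ (X - C z) : ℂ[X]) : PowerSeries ℂ) *
        (((taylor ζ B₁ : ℂ[X]) : PowerSeries ℂ) * a -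
          ((taylor ζ A₁ : ℂ[X]) : PowerSeries ℂ)) := by
      rw [taylor_mul, taylor_mul, Polynomial.coe_mul, Polynomial.coe_mul]
      ring
    rw [h1, hu.dvd_mul_left] at hd
    have h2 : ((taylor ζ (C (ζ - z) * B₁) : ℂ[X]) : PowerSeries ℂ) * a -
        ((taylor ζ (C (ζ - z) * A₁) : ℂ[X]) : PowerSeries ℂ) =
        ((taylor ζ (C (ζ - z)) : ℂ[X]) : PowerSeries ℂ) *
        (((taylor ζ B₁ : ℂ[X]) : PowerSeries ℂ) * a -
          ((taylor ζ A₁ : ℂ[X]) : PowerSeries ℂ)) := by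
      rw [taylor_mul, taylor_mul, Polynomial.coe_mul, Polynomial.coe_mul]
      ring
    rw [h2]
    exact hd.mul_left _
  have hB := (h.unique hD h').2
  have h0 : (X - C ζ) * B₁ = 0 := by
    rw [C_sub] at hB
    linear_combination hB
  rcases mul_eq_zero.1 h0 with h0 | h0
  · exact X_sub_C_ne_zero ζ h0
  · have := h.2.2.1
    rw [h0, mul_zero, eval_zero] at this
    exact zero_ne_one this

/-- The polynomial with constant term `1` whose coefficient of order `q - j` is `x j`. -/
noncomputable def denomOfVec {q : ℕ} (x : Fin q → ℂ) : ℂ[X] :=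
  1 + ∑ j : Fin q, C (x j) * X ^ (q - j)

theorem natDegree_denomOfVec_le {q : ℕ} (x : Fin q → ℂ) : (denomOfVec x).natDegree ≤ q := by
  refine (natDegree_add_le _ _).trans (max_le (by simp) ?_)
  refine natDegree_sum_le_of_forall_le _ _ fun j _ => ?_
  exact (natDegree_C_mul_X_pow_le _ _).trans (Nat.sub_le _ _)

theorem coeff_denomOfVec {q : ℕ} (x : Fin q → ℂ) (k : ℕ) : (denomOfVec x).coeff k =
    (if k = 0 then 1 else 0) + ∑ j : Fin q, if k = q - j then x j else 0 := by
  simp [denomOfVec, coeff_one, finsetSum_coeff]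

theorem coeff_denomOfVec_zero {q : ℕ} (x : Fin q → ℂ) : (denomOfVec x).coeff 0 = 1 := by
  rw [coeff_denomOfVec, if_pos rfl, Finset.sum_eq_zero, add_zero]
  intro j _
  rw [if_neg]
  have := j.2
  omega

theorem coeff_denomOfVec_sub {q : ℕ} (x : Fin q → ℂ) (j : Fin q) :
    (denomOfVec x).coeff (q - j) = x j := by
  have hj := j.2
  rw [coeff_denomOfVec, if_neg (by omega), zero_add, Finset.sum_eq_single j]
  · rw [if_pos rfl]
  · intro i _ hij
    rw [if_neg]
    intro h
    have := i.2
    exact hij (Fin.ext (by omega))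
  · simp

/-- The solution of the Hankel system by Cramer's rule. -/
noncomputable def padeVec (a : PowerSeries ℂ) (p q : ℕ) : Fin q → ℂ :=
  -((hankelMatrix a p q).det⁻¹ •
    (hankelMatrix a p q).adjugate.mulVec fun i => PowerSeries.coeff (p + 1 + i) a)

/-- Denominator and numerator are polynomials in the local variable `z - ζ`; `taylor (-ζ)` brings
them back to `z`. -/
noncomputable def padeDenom (a : PowerSeries ℂ) (p q : ℕ) : ℂ[X] := denomOfVec (padeVec a p q)

noncomputable def padeNum (a : PowerSeries ℂ) (p q : ℕ) : ℂ[X] :=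
  PowerSeries.trunc (p + 1) ((padeDenom a p q : PowerSeries ℂ) * a)

theorem isPadePair_padeNum_padeDenom {a : PowerSeries ℂ} {p q : ℕ} (ζ : ℂ)
    (hD : MemPadeD a p q) : IsPadePair a ζ p q (taylor (-ζ) (padeNum a p q))
      (taylor (-ζ) (padeDenom a p q)) := by
  have ht : ∀ P : ℂ[X], taylor ζ (taylor (-ζ) P) = P := fun P => by
    rw [taylor_taylor]
    simp
  refine ⟨?_, ?_, ?_, ?_⟩
  · rw [natDegree_taylor]
    exact Nat.lt_succ_iff.1 (PowerSeries.natDegree_trunc_lt _ _)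
  · rw [natDegree_taylor]
    exact natDegree_denomOfVec_le _
  · rw [← taylor_coeff_zero, ht]
    exact coeff_denomOfVec_zero _
  · rw [ht, ht, PowerSeries.X_pow_dvd_iff]
    intro m hm
    rw [map_sub, Polynomial.coeff_coe, padeNum, PowerSeries.coeff_trunc]
    split_ifs with h
    · exact sub_self _
    · obtain ⟨i, rfl⟩ := Nat.exists_eq_add_of_le (not_lt.1 h)
      have := coeff_coe_mul_eq_hankel_mulVec (padeDenom a p q) a (natDegree_denomOfVec_le _)
        (coeff_denomOfVec_zero _) p ⟨i, by omega⟩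
      rw [sub_zero, this]
      simp only [padeDenom, coeff_denomOfVec_sub]
      rw [padeVec, Matrix.mulVec_neg, Matrix.mulVec_smul, Matrix.mulVec_mulVec,
        Matrix.mul_adjugate, Matrix.smul_mulVec, Matrix.one_mulVec, inv_smul_smul₀ hD]
      simp

section Continuity

variable {Y : Type*} [TopologicalSpace Y] {a : Y → PowerSeries ℂ}

theorem continuous_intCoeff (ha : ∀ ν, Continuous fun y => PowerSeries.coeff ν (a y)) (k : ℤ) :
    Continuous fun y => intCoeff (a y) k := by
  unfold intCoeff
  split_ifs
  · exact ha _
  · exact continuous_const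

theorem continuous_hankelMatrix (ha : ∀ ν, Continuous fun y => PowerSeries.coeff ν (a y))
    (p q : ℕ) : Continuous fun y => hankelMatrix (a y) p q :=
  continuous_matrix fun _ _ => continuous_intCoeff ha _

theorem isOpen_setOf_memPadeD (ha : ∀ ν, Continuous fun y => PowerSeries.coeff ν (a y))
    (p q : ℕ) : IsOpen {y | MemPadeD (a y) p q} :=
  isOpen_ne_fun (continuous_hankelMatrix ha p q).matrix_det continuous_const

theorem continuousAt_padeVec (ha : ∀ ν, Continuous fun y => PowerSeries.coeff ν (a y))
    {p q : ℕ} {y : Y} (hD : MemPadeD (a y) p q) :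
    ContinuousAt (fun y => padeVec (a y) p q) y := by
  have hH := continuous_hankelMatrix ha p q
  refine (ContinuousAt.smul (hH.matrix_det.continuousAt.inv₀ hD) ?_).neg
  exact (hH.matrix_adjugate.matrix_mulVec (continuous_pi fun _ => ha _)).continuousAt

theorem continuousAt_coeff_padeDenom (ha : ∀ ν, Continuous fun y => PowerSeries.coeff ν (a y))
    {p q : ℕ} {y : Y} (hD : MemPadeD (a y) p q) (k : ℕ) :
    ContinuousAt (fun y => (padeDenom (a y) p q).coeff k) y := by
  simp only [padeDenom, coeff_denomOfVec]
  refine continuousAt_const.add (tendsto_finsetSum _ fun j _ => ?_)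
  split_ifs
  · exact (continuousAt_pi.1 (continuousAt_padeVec ha hD) j)
  · exact tendsto_const_nhds

theorem continuousAt_coeff_padeNum (ha : ∀ ν, Continuous fun y => PowerSeries.coeff ν (a y))
    {p q : ℕ} {y : Y} (hD : MemPadeD (a y) p q) (k : ℕ) :
    ContinuousAt (fun y => (padeNum (a y) p q).coeff k) y := by
  simp only [padeNum, PowerSeries.coeff_trunc,
    coeff_coe_mul_eq_sum_intCoeff _ _ (natDegree_denomOfVec_le (padeVec (a _) p q)), padeDenom]
  split_ifs
  · refine tendsto_finsetSum _ fun j _ => ?_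
    exact (continuousAt_coeff_padeDenom ha hD j).mul (continuous_intCoeff ha _).continuousAt
  · exact continuousAt_const

theorem continuousAt_eval_taylor {P : Y → ℂ[X]} {n : ℕ} (hn : ∀ y, (P y).natDegree ≤ n) {y : Y}
    (hP : ∀ k, ContinuousAt (fun y => (P y).coeff k) y) (ζ z : ℂ) :
    ContinuousAt (fun w : Y × ℂ => (taylor ζ (P w.1)).eval w.2) (y, z) := by
  have h1 : ∀ w : Y × ℂ, (taylor ζ (P w.1)).eval w.2 =
      ∑ k ∈ Finset.range (n + 1), (P w.1).coeff k * (w.2 + ζ) ^ k := fun w => by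
    rw [taylor_eval, eval_eq_sum_range' (Nat.lt_succ_iff.2 (hn w.1)), Nat.succ_eq_add_one]
  simp only [h1]
  refine tendsto_finsetSum _ fun k _ => ?_
  refine ContinuousAt.mul ?_ (by fun_prop)
  exact ContinuousAt.comp (f := Prod.fst) (x := (y, z)) (hP k) continuousAt_fst

theorem exists_isPadePair_continuousAt
    (ha : ∀ ν, Continuous fun y => PowerSeries.coeff ν (a y)) (ζ : ℂ) (p q : ℕ) :
    ∃ A B : Y → ℂ[X], ∀ y, MemPadeD (a y) p q → IsPadePair (a y) ζ p q (A y) (B y) ∧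
      ∀ z, ContinuousAt (fun w : Y × ℂ => (A w.1).eval w.2) (y, z) ∧
        ContinuousAt (fun w : Y × ℂ => (B w.1).eval w.2) (y, z) :=
  ⟨fun y => taylor (-ζ) (padeNum (a y) p q), fun y => taylor (-ζ) (padeDenom (a y) p q),
    fun _ hD => ⟨isPadePair_padeNum_padeDenom ζ hD, fun _ =>
      ⟨continuousAt_eval_taylor (fun _ => Nat.lt_succ_iff.1 (PowerSeries.natDegree_trunc_lt _ _))
          (continuousAt_coeff_padeNum ha hD) _ _,
        continuousAt_eval_taylor (fun _ => natDegree_denomOfVec_le _)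
          (continuousAt_coeff_padeDenom ha hD) _ _⟩⟩⟩

end Continuity

theorem intCoeff_natCast (a : PowerSeries ℂ) (n : ℕ) :
    intCoeff a n = PowerSeries.coeff n a := by
  simp [intCoeff]

theorem memPadeD_of_coeff_eq_zero {a : PowerSeries ℂ} {p : ℕ} (hp : PowerSeries.coeff p a ≠ 0)
    (h0 : ∀ n, p < n → PowerSeries.coeff n a = 0) (q : ℕ) : MemPadeD a p q := by
  -- Reversing the rows changes the determinant by a sign only and leaves a triangular matrix with
  -- `a_p` on the diagonal.
  have h1 : (hankelMatrix a p q).submatrix Fin.revPerm id =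
      Matrix.of fun i j : Fin q => intCoeff a ((p : ℤ) + (j : ℕ) - (i : ℕ)) := by
    ext i j
    simp only [hankelMatrix, Matrix.submatrix_apply, Matrix.of_apply, id, Fin.revPerm_apply,
      Fin.val_rev]
    congr 1
    have := i.2
    omega
  have h2 := Matrix.det_permute Fin.revPerm (hankelMatrix a p q)
  rw [h1, Matrix.det_of_isLowerTriangular] at h2
  · intro h
    rw [h, mul_zero, Finset.prod_eq_zero_iff] at h2
    obtain ⟨i, -, hi⟩ := h2
    rw [Matrix.of_apply, add_sub_cancel_right, intCoeff_natCast] at hi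
    exact hp hi
  · intro i j hij
    have hij' : (i : ℕ) < j := by simpa using hij
    rw [Matrix.of_apply]
    have : (p : ℤ) + (j : ℕ) - (i : ℕ) = ((p + (j - i) : ℕ) : ℤ) := by omega
    rw [this, intCoeff_natCast]
    exact h0 _ (by omega)

theorem isPadePair_self {P : ℂ[X]} {p : ℕ} (hP : P.natDegree ≤ p) (ζ : ℂ) (q : ℕ) :
    IsPadePair (taylor ζ P : PowerSeries ℂ) ζ p q P 1 :=
  ⟨hP, by simp, by simp, by simp⟩

theorem memPadeD_taylor {P : ℂ[X]} {p : ℕ} (hP : P.natDegree ≤ p) {ζ : ℂ}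
    (hc : (taylor ζ P).coeff p ≠ 0) (q : ℕ) :
    MemPadeD (taylor ζ P : PowerSeries ℂ) p q := by
  refine memPadeD_of_coeff_eq_zero (by rwa [Polynomial.coeff_coe]) (fun n hn => ?_) q
  rw [Polynomial.coeff_coe, Polynomial.coeff_eq_zero_of_natDegree_lt]
  rw [natDegree_taylor]
  omega

theorem IsPadePair.denom_ne_zero {a : PowerSeries ℂ} {ζ : ℂ} {p q : ℕ} {A B : ℂ[X]}
    (h : IsPadePair a ζ p q A B) : B ≠ 0 := by
  rintro rfl
  simpa using h.2.2.1

theorem num_mul_eq_mul_denom {A B : ℂ[X]} (hB : B ≠ 0) :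
    (algebraMap ℂ[X] (RatFunc ℂ) A / algebraMap ℂ[X] (RatFunc ℂ) B).num * B =
      A * (algebraMap ℂ[X] (RatFunc ℂ) A / algebraMap ℂ[X] (RatFunc ℂ) B).denom := by
  set Φ := algebraMap ℂ[X] (RatFunc ℂ) A / algebraMap ℂ[X] (RatFunc ℂ) B with hΦ
  have h1 : algebraMap ℂ[X] (RatFunc ℂ) Φ.num / algebraMap ℂ[X] (RatFunc ℂ) Φ.denom = Φ :=
    RatFunc.num_div_denom Φ
  rw [hΦ, div_eq_div_iff (by simpa using RatFunc.denom_ne_zero Φ) (by simpa using hB),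
    ← map_mul, ← map_mul] at h1
  exact RatFunc.algebraMap_injective ℂ h1

theorem IsPadePair.ratSupDist_le {a : PowerSeries ℂ} {ζ : ℂ} {p q : ℕ} {A B : ℂ[X]}
    (h : IsPadePair a ζ p q A B) {g : ℂ → ℂ} {E : Set ℂ} {ε : ℝ}
    (hE : ∀ z ∈ E, ‖A.eval z - g z * B.eval z‖ < ε * ‖B.eval z‖) :
    ratSupDist (algebraMap ℂ[X] (RatFunc ℂ) A / algebraMap ℂ[X] (RatFunc ℂ) B) g E ≤
      ENNReal.ofReal ε := by
  have hnd := num_mul_eq_mul_denom (A := A) h.denom_ne_zero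
  set Φ := algebraMap ℂ[X] (RatFunc ℂ) A / algebraMap ℂ[X] (RatFunc ℂ) B with hΦ
  refine iSup₂_le fun z hz => ?_
  have h1 := hE z hz
  have hBz : B.eval z ≠ 0 := fun h0 => by
    rw [h0, mul_zero, norm_zero, mul_zero] at h1
    exact absurd h1 (not_lt.2 (norm_nonneg _))
  have hden : Φ.denom.eval z ≠ 0 := fun h0 =>
    hBz (eval_eq_zero_of_dvd_of_eval_eq_zero (RatFunc.denom_div_dvd A B) h0)
  rw [if_neg hden, ← ofReal_norm]
  refine ENNReal.ofReal_le_ofReal ?_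
  have h2 := congr_arg (eval z) hnd
  rw [eval_mul, eval_mul] at h2
  have h3 : Φ.eval (RingHom.id ℂ) z - g z = (A.eval z - g z * B.eval z) / B.eval z := by
    rw [RatFunc.eval, ← Polynomial.eval, ← Polynomial.eval, div_sub' hden,
      div_eq_div_iff hden hBz]
    linear_combination h2
  rw [h3, norm_div, div_le_iff₀ (norm_pos_iff.2 hBz)]
  exact h1.le

/-- The Hankel condition is essential: it rules out a zero of `B` cancelled by one of `A`, which
would be invisible in the reduced fraction `Φ` but violate the strict inequality. -/
theorem IsPadePair.norm_sub_lt {a : PowerSeries ℂ} {ζ : ℂ} {p q : ℕ} {A B : ℂ[X]}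
    (hD : MemPadeD a p q) (h : IsPadePair a ζ p q A B) {g : ℂ → ℂ} {E : Set ℂ} {ε : ℝ}
    (hE : ratSupDist (algebraMap ℂ[X] (RatFunc ℂ) A / algebraMap ℂ[X] (RatFunc ℂ) B) g E <
      ENNReal.ofReal ε) {z : ℂ} (hz : z ∈ E) :
    ‖A.eval z - g z * B.eval z‖ < ε * ‖B.eval z‖ := by
  have hnd := num_mul_eq_mul_denom (A := A) h.denom_ne_zero
  set Φ := algebraMap ℂ[X] (RatFunc ℂ) A / algebraMap ℂ[X] (RatFunc ℂ) B with hΦ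
  have h1 := (le_iSup₂ (f := fun z (_ : z ∈ E) => if Φ.denom.eval z = 0 then (⊤ : ℝ≥0∞) else
    ‖Φ.eval (RingHom.id ℂ) z - g z‖ₑ) z hz).trans_lt hE
  have h2 := congr_arg (eval z) hnd
  rw [eval_mul, eval_mul] at h2
  have hden : Φ.denom.eval z ≠ 0 := fun h0 => by
    rw [if_pos h0] at h1
    exact not_top_lt h1
  have hBz : B.eval z ≠ 0 := fun h0 => by
    rw [h0, mul_zero, eq_comm, mul_eq_zero] at h2
    exact h2.elim (h.eval_ne_zero hD h0) hden
  rw [if_neg hden, ← ofReal_norm] at h1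
  have h3 : Φ.eval (RingHom.id ℂ) z - g z = (A.eval z - g z * B.eval z) / B.eval z := by
    rw [RatFunc.eval, ← Polynomial.eval, ← Polynomial.eval, div_sub' hden,
      div_eq_div_iff hden hBz]
    linear_combination h2
  have h4 := (ENNReal.ofReal_lt_ofReal_iff_of_nonneg (norm_nonneg _)).1 h1
  rwa [h3, norm_div, div_lt_iff₀ (norm_pos_iff.2 hBz)] at h4

end Pade

/-! ### The topology of `ℋ(Ω)` -/

section HolFunTopology

variable {Ω : Set ℂ}

theorem HolFun.toFun_apply (f : HolFun Ω) {z : ℂ} (hz : z ∈ Ω) : f.toFun z = f.1 ⟨z, hz⟩ :=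
  Subtype.val_injective.extend_apply f.1 0 ⟨z, hz⟩

theorem HolFun.differentiableOn_toFun (f : HolFun Ω) : DifferentiableOn ℂ f.toFun Ω := f.2

/-- The restriction to `Ω` of a function holomorphic in `Ω`. -/
def HolFun.ofDifferentiableOn {F : ℂ → ℂ} (hF : DifferentiableOn ℂ F Ω) : HolFun Ω :=
  ⟨⟨fun z : Ω => F z, continuousOn_iff_continuous_domRestrict.1 hF.continuousOn⟩,
    hF.congr fun z hz => Subtype.val_injective.extend_apply (fun z : Ω => F z) 0 ⟨z, hz⟩⟩

theorem HolFun.toFun_ofDifferentiableOn {F : ℂ → ℂ} (hF : DifferentiableOn ℂ F Ω) {z : ℂ}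
    (hz : z ∈ Ω) : (HolFun.ofDifferentiableOn hF).toFun z = F z :=
  HolFun.toFun_apply _ hz

theorem tendstoLocallyUniformlyOn_extend (hΩ : IsOpen Ω) {ι : Type*} {l : Filter ι}
    {F : ι → C(Ω, ℂ)} {f : C(Ω, ℂ)} (h : Tendsto F l (𝓝 f)) :
    TendstoLocallyUniformlyOn (fun i => Function.extend Subtype.val (F i) 0)
      (Function.extend Subtype.val f 0) l Ω := by
  have : LocallyCompactSpace Ω := hΩ.locallyCompactSpace
  rw [tendstoLocallyUniformlyOn_iff_tendstoLocallyUniformly_comp_coe]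
  have h1 := ContinuousMap.tendsto_iff_tendstoLocallyUniformly.1 h
  convert! h1 using 1
  · ext i z
    exact Subtype.val_injective.extend_apply _ _ _
  · ext z
    exact Subtype.val_injective.extend_apply _ _ _

theorem isClosed_setOf_differentiableOn (hΩ : IsOpen Ω) :
    IsClosed {f : C(Ω, ℂ) | DifferentiableOn ℂ (Function.extend Subtype.val f 0) Ω} := by
  refine isClosed_of_closure_subset fun f hf => ?_
  have : (𝓝[{f : C(Ω, ℂ) | DifferentiableOn ℂ (Function.extend Subtype.val f 0) Ω}] f).NeBot :=
    mem_closure_iff_nhdsWithin_neBot.1 hf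
  exact TendstoLocallyUniformlyOn.differentiableOn
    (φ := 𝓝[{f : C(Ω, ℂ) | DifferentiableOn ℂ (Function.extend Subtype.val f 0) Ω}] f)
    (tendstoLocallyUniformlyOn_extend hΩ (F := fun g : C(Ω, ℂ) => g) nhdsWithin_le_nhds)
    self_mem_nhdsWithin hΩ

/-- By Weierstrass' theorem `ℋ(Ω)` is closed in the complete space `C(Ω, ℂ)`, whose uniformity is
countably generated. -/
theorem baireSpace_holFun (hΩ : IsOpen Ω) : BaireSpace (HolFun Ω) := by
  have : LocallyCompactSpace Ω := hΩ.locallyCompactSpace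
  have : CompleteSpace (HolFun Ω) := (isClosed_setOf_differentiableOn hΩ).completeSpace_coe
  have : (uniformity (HolFun Ω)).IsCountablyGenerated := by
    rw [uniformity_subtype]
    infer_instance
  let := UniformSpace.pseudoMetricSpace (HolFun Ω)
  infer_instance

theorem continuous_coeff_taylorSeriesAt (hΩ : IsOpen Ω) {ζ : ℂ} (hζ : ζ ∈ Ω) (ν : ℕ) :
    Continuous fun f : HolFun Ω => PowerSeries.coeff ν (taylorSeriesAt f.toFun ζ) := by
  simp only [taylorSeriesAt, PowerSeries.coeff_mk]
  refine Continuous.div_const ?_ _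
  rw [continuous_iff_continuousAt]
  intro f
  have h0 : TendstoLocallyUniformlyOn (fun g : HolFun Ω => g.toFun) f.toFun (𝓝 f) Ω :=
    tendstoLocallyUniformlyOn_extend hΩ continuous_subtype_val.continuousAt
  have hdiff : ∀ (k : ℕ) (g : HolFun Ω), DifferentiableOn ℂ (iteratedDeriv k g.toFun) Ω := by
    intro k g
    induction k with
    | zero => simpa using g.differentiableOn_toFun
    | succ k ih =>
      rw [iteratedDeriv_succ]
      exact ih.deriv hΩ
  have h1 : ∀ k, TendstoLocallyUniformlyOn (fun g : HolFun Ω => iteratedDeriv k g.toFun)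
      (iteratedDeriv k f.toFun) (𝓝 f) Ω := by
    intro k
    induction k with
    | zero => simpa using h0
    | succ k ih =>
      simp only [iteratedDeriv_succ]
      exact ih.deriv (Eventually.of_forall fun g => hdiff k g) hΩ
  exact (h1 ν).tendsto_at hζ

theorem continuousAt_toFun_eval (hΩ : IsOpen Ω) (f : HolFun Ω) {z : ℂ} (hz : z ∈ Ω) :
    ContinuousAt (fun w : HolFun Ω × ℂ => w.1.toFun w.2) (f, z) := by
  have : LocallyCompactSpace Ω := hΩ.locallyCompactSpace
  have he : IsOpenEmbedding (Prod.map (id : HolFun Ω → HolFun Ω) (Subtype.val : Ω → ℂ)) :=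
    IsOpenEmbedding.id.prodMap hΩ.isOpenEmbedding_subtypeVal
  refine (he.continuousAt_iff (x := (f, (⟨z, hz⟩ : Ω)))).1 ?_
  have h2 : (fun w : HolFun Ω × ℂ => w.1.toFun w.2) ∘
      Prod.map (id : HolFun Ω → HolFun Ω) (Subtype.val : Ω → ℂ) =
      fun w : HolFun Ω × Ω => w.1.1 w.2 := by
    ext w
    exact w.1.toFun_apply w.2.2
  rw [h2]
  have h3 : Continuous fun w : HolFun Ω × Ω => w.1.1 w.2 := by fun_prop
  exact h3.continuousAt

theorem mem_closure_of_forall_innerCompact (hΩ : IsOpen Ω) {S : Set (HolFun Ω)} {f : HolFun Ω}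
    (h : ∀ (N : ℕ) (δ : ℝ), 0 < δ → ∃ g ∈ S, ∀ z ∈ innerCompact Ω N,
      ‖g.toFun z - f.toFun z‖ < δ) : f ∈ closure S := by
  choose G hGS hG using fun N : ℕ => h N (1 / ((N : ℝ) + 1)) (by positivity)
  refine mem_closure_of_tendsto (f := G) (b := atTop) ?_ (Eventually.of_forall hGS)
  rw [tendsto_subtype_rng, ContinuousMap.tendsto_iff_forall_isCompact_tendstoUniformlyOn]
  intro K hK
  rw [Metric.tendstoUniformlyOn_iff]
  intro ε hε
  have hL : IsCompact (Subtype.val '' K) := hK.image continuous_subtype_val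
  filter_upwards [eventually_subset_innerCompact hΩ hL (by simp),
    tendsto_one_div_add_atTop_nhds_zero_nat.eventually_lt_const hε] with n hn hn' z hz
  have := hG n z (hn ⟨z, hz, rfl⟩)
  rw [HolFun.toFun_apply _ z.2, HolFun.toFun_apply _ z.2] at this
  rw [dist_comm, dist_eq_norm]
  exact this.trans hn'

end HolFunTopology

/-! ### Countable families of compacts and polynomials -/

section CompactFamily

/-- A countable family of compact subsets of `ℂ ∖ Ω`: closed discs around `0` without `Ω` and
finitely many discs. -/
def outerCompact (Ω : Set ℂ) (i : ℕ × Finset (ℕ × ℕ)) : Set ℂ :=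
  (Metric.closedBall 0 i.1 ∩ Ωᶜ) \
    ⋃ p ∈ i.2, Metric.ball (TopologicalSpace.denseSeq ℂ p.1) (1 / ((p.2 : ℝ) + 1))

theorem isCompact_outerCompact {Ω : Set ℂ} (hΩ : IsOpen Ω) (i : ℕ × Finset (ℕ × ℕ)) :
    IsCompact (outerCompact Ω i) :=
  ((isCompact_closedBall 0 _).inter_right hΩ.isClosed_compl).diff
    (isOpen_biUnion fun _ _ => Metric.isOpen_ball)

theorem outerCompact_subset (Ω : Set ℂ) (i : ℕ × Finset (ℕ × ℕ)) : outerCompact Ω i ⊆ Ωᶜ :=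
  fun _ hz => hz.1.2

theorem isPreconnected_setOf_lt_norm {r : ℝ} (hr : 0 ≤ r) : IsPreconnected {z : ℂ | r < ‖z‖} := by
  have h1 : {z : ℂ | r < ‖z‖} = (fun p : ℝ × ℝ => (p.1 : ℂ) * Complex.exp (p.2 * Complex.I)) ''
      (Set.Ioi r ×ˢ Set.univ) := by
    ext z
    constructor
    · intro hz
      exact ⟨(‖z‖, z.arg), ⟨hz, trivial⟩, Complex.norm_mul_exp_arg_mul_I z⟩
    · rintro ⟨⟨s, θ⟩, ⟨hs, -⟩, rfl⟩
      have hs' : r < s := hs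
      simpa [abs_of_pos (hr.trans_lt hs')] using hs'
  rw [h1]
  exact (isPreconnected_Ioi.prod isPreconnected_univ).image _ (by fun_prop)

theorem exists_ball_denseSeq {U : Set ℂ} (hU : IsOpen U) {x : ℂ} (hx : x ∈ U) :
    ∃ p : ℕ × ℕ, x ∈ Metric.ball (TopologicalSpace.denseSeq ℂ p.1) (1 / ((p.2 : ℝ) + 1)) ∧
      Metric.ball (TopologicalSpace.denseSeq ℂ p.1) (1 / ((p.2 : ℝ) + 1)) ⊆ U := by
  obtain ⟨ε, hε, hb⟩ := Metric.isOpen_iff.1 hU x hx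
  obtain ⟨j, hj⟩ := exists_nat_one_div_lt (half_pos hε)
  obtain ⟨i, hi⟩ := (TopologicalSpace.denseRange_denseSeq ℂ).exists_dist_lt x
    (show (0 : ℝ) < 1 / ((j : ℝ) + 1) by positivity)
  refine ⟨(i, j), hi, fun y hy => hb ?_⟩
  rw [Metric.mem_ball] at hy ⊢
  have := dist_triangle y (TopologicalSpace.denseSeq ℂ i) x
  rw [dist_comm x] at hi
  dsimp only at hy
  linarith

/-- A path `γ` off `K` joins `ζ` to a point beyond a disc containing `K`. Finitely many basic discs
off `K`, each meeting `γ`, cover it. Removing them leaves a compact whose complement is the exterior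
of the large disc, `Ω` and the small discs, all tied together by `γ`. -/
theorem exists_subset_outerCompact {Ω : Set ℂ} (hΩc : IsConnected Ω) {K : Set ℂ}
    (hK : IsCompact K) (hKΩ : K ⊆ Ωᶜ) (hKc : IsConnected Kᶜ) :
    ∃ i, IsConnected (outerCompact Ω i)ᶜ ∧ K ⊆ outerCompact Ω i := by
  obtain ⟨ζ, hζ⟩ := hΩc.nonempty
  obtain ⟨R, hR⟩ := hK.isBounded.exists_norm_le
  obtain ⟨m, hm⟩ := exists_nat_ge R
  have hw : (m : ℝ) < ‖((m : ℂ) + 1)‖ := by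
    have : ((m : ℂ) + 1) = ((m + 1 : ℕ) : ℂ) := by push_cast; rfl
    rw [this, Complex.norm_natCast]
    push_cast
    linarith
  obtain ⟨γ, hγ⟩ := (hK.isClosed.isOpen_compl.isConnected_iff_isPathConnected.1 hKc).joinedIn ζ
    (fun h => hKΩ h hζ) ((m : ℂ) + 1) (fun h => by linarith [hR _ h])
  have hγc : IsPreconnected (Set.range γ) := isPreconnected_range γ.continuous
  set D : ℕ × ℕ → Set ℂ := fun p =>
    Metric.ball (TopologicalSpace.denseSeq ℂ p.1) (1 / ((p.2 : ℝ) + 1)) with hD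
  obtain ⟨b, hb, hbf, hcov⟩ := (isCompact_range γ.continuous).elim_finite_subcover_image
    (b := {p | D p ⊆ Kᶜ ∧ (Set.range γ ∩ D p).Nonempty}) (c := D)
    (fun _ _ => Metric.isOpen_ball) (by
      rintro _ ⟨t, rfl⟩
      obtain ⟨p, hp, hpK⟩ := exists_ball_denseSeq hK.isClosed.isOpen_compl (hγ t)
      exact Set.mem_biUnion (show p ∈ _ from ⟨hpK, γ t, ⟨t, rfl⟩, hp⟩) hp)
  have hcompl : (outerCompact Ω (m, hbf.toFinset))ᶜ =
      {z : ℂ | (m : ℝ) < ‖z‖} ∪ Ω ∪ ⋃ p ∈ b, D p := by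
    ext z
    simp only [outerCompact, hD, Set.mem_compl_iff, Set.mem_sdiff, Set.mem_inter_iff,
      mem_closedBall_zero_iff, Set.Finite.mem_toFinset, Set.mem_union, Set.mem_ofPred_eq]
    rw [not_and_or, not_and_or, not_not, not_not, not_le]
  have hγsub : Set.range γ ⊆ {z : ℂ | (m : ℝ) < ‖z‖} ∪ Ω ∪ ⋃ p ∈ b, D p :=
    hcov.trans Set.subset_union_right
  have hζγ : ζ ∈ Set.range γ := ⟨0, γ.source⟩
  refine ⟨(m, hbf.toFinset), ⟨⟨ζ, fun h => outerCompact_subset Ω _ h hζ⟩, ?_⟩, fun z hz =>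
    ⟨⟨?_, hKΩ hz⟩, ?_⟩⟩
  · rw [hcompl]
    refine isPreconnected_of_forall ζ fun y hy => ?_
    rcases hy with (hy | hy) | hy
    · refine ⟨Set.range γ ∪ {z : ℂ | (m : ℝ) < ‖z‖}, Set.union_subset hγsub
        (Set.subset_union_left.trans Set.subset_union_left), Or.inl hζγ, Or.inr hy, ?_⟩
      exact hγc.union _ ⟨1, γ.target⟩ hw (isPreconnected_setOf_lt_norm m.cast_nonneg)
    · exact ⟨Ω, Set.subset_union_right.trans Set.subset_union_left, hζ, hy, hΩc.isPreconnected⟩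
    · obtain ⟨p, hp, hyp⟩ := Set.mem_iUnion₂.1 hy
      refine ⟨Set.range γ ∪ D p, Set.union_subset hγsub
        ((Set.subset_biUnion_of_mem hp).trans Set.subset_union_right), Or.inl hζγ,
        Or.inr hyp, ?_⟩
      obtain ⟨x, hx, hx'⟩ := (hb hp).2
      exact hγc.union x hx hx' (convex_ball _ _).isPreconnected
  · exact mem_closedBall_zero_iff.2 ((hR z hz).trans hm)
  · intro h
    obtain ⟨p, hp, hzp⟩ := Set.mem_iUnion₂.1 h
    exact (hb (hbf.mem_toFinset.1 hp)).1 hzp hz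

theorem exists_countable_polynomials_dense :
    ∃ H : Set ℂ[X], H.Countable ∧ ∀ (h : ℂ[X]) (K : Set ℂ), IsCompact K → ∀ ε > 0,
      ∃ h' ∈ H, ∀ z ∈ K, ‖h'.eval z - h.eval z‖ < ε := by
  -- Polynomials inherit second countability, hence separability, from `C(ℂ, ℂ)`.
  let : TopologicalSpace ℂ[X] := TopologicalSpace.induced (Polynomial.toContinuousMap) inferInstance
  have : SecondCountableTopology ℂ[X] :=
    Topology.IsInducing.secondCountableTopology (f := Polynomial.toContinuousMap) ⟨rfl⟩
  obtain ⟨H, hH, hHd⟩ := TopologicalSpace.exists_countable_dense ℂ[X]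
  refine ⟨H, hH, fun h K hK ε hε => ?_⟩
  have h1 : Tendsto (Polynomial.toContinuousMap : ℂ[X] → C(ℂ, ℂ)) (𝓝 h)
      (𝓝 h.toContinuousMap) := continuous_induced_dom.continuousAt
  have h2 := Metric.tendstoUniformlyOn_iff.1
    (ContinuousMap.tendsto_iff_forall_isCompact_tendstoUniformlyOn.1 h1 K hK) ε hε
  obtain ⟨h', hh', hh'H⟩ := mem_closure_iff_nhds.1 (hHd h) _ h2
  refine ⟨h', hh'H, fun z hz => ?_⟩
  have := hh' z hz
  rw [dist_comm, dist_eq_norm] at this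
  simpa using this

end CompactFamily

/-! ### Open dense sets and universality -/

section Universality

theorem taylorSeriesAt_eq_of_eventuallyEq {F : ℂ → ℂ} {P : ℂ[X]} {ζ : ℂ}
    (h : F =ᶠ[𝓝 ζ] fun z => P.eval z) :
    taylorSeriesAt F ζ = (taylor ζ P : PowerSeries ℂ) := by
  have hder : ∀ ν, iteratedDeriv ν (fun z => P.eval z) = fun z => (derivative^[ν] P).eval z := by
    intro ν
    induction ν with
    | zero => simp
    | succ k ih =>
      rw [iteratedDeriv_succ, ih, Function.iterate_succ_apply']
      ext z
      exact Polynomial.deriv _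
  ext ν
  rw [taylorSeriesAt, PowerSeries.coeff_mk, h.iteratedDeriv_eq, hder, Polynomial.coeff_coe,
    taylor_coeff, ← factorial_smul_hasseDeriv]
  have : (ν.factorial : ℂ) ≠ 0 := Nat.cast_ne_zero.2 ν.factorial_ne_zero
  simp [mul_div_cancel_left₀ _ this]

/-- The functions one of whose Padé approximants with index in `𝔉` is `1 / (n + 1)`-close to `h`
on `K` and to the function itself on the `n`-th compact set of the exhaustion of `Ω`. -/
def padeApproxSet (𝔉 : Set (ℕ × ℕ)) (Ω : Set ℂ) (ζ : ℂ) (K : Set ℂ) (h : ℂ[X]) (n : ℕ) :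
    Set (HolFun Ω) :=
  {f | ∃ (p q : ℕ) (A B : ℂ[X]), (p, q) ∈ 𝔉 ∧ MemPadeD (taylorSeriesAt f.toFun ζ) p q ∧
    IsPadePair (taylorSeriesAt f.toFun ζ) ζ p q A B ∧
    (∀ z ∈ K, ‖A.eval z - h.eval z * B.eval z‖ < 1 / ((n : ℝ) + 1) * ‖B.eval z‖) ∧
    ∀ z ∈ innerCompact Ω n,
      ‖A.eval z - f.toFun z * B.eval z‖ < 1 / ((n : ℝ) + 1) * ‖B.eval z‖}

variable {𝔉 : Set (ℕ × ℕ)} {Ω : Set ℂ} {ζ : ℂ} {K : Set ℂ}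

theorem isOpen_padeApproxSet (hΩ : IsOpen Ω) (hζ : ζ ∈ Ω) (hK : IsCompact K) (h : ℂ[X])
    (n : ℕ) : IsOpen (padeApproxSet 𝔉 Ω ζ K h n) := by
  rw [isOpen_iff_mem_nhds]
  rintro f ⟨p, q, A, B, hpq, hD, hAB, hAK, hAL⟩
  have ha := continuous_coeff_taylorSeriesAt hΩ hζ
  obtain ⟨A', B', hA'B'⟩ := exists_isPadePair_continuousAt ha ζ p q
  obtain ⟨hf, hc⟩ := hA'B' f hD
  obtain ⟨rfl, rfl⟩ := hAB.unique hD hf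
  have h1 : ∀ᶠ g in 𝓝 f, ∀ z ∈ K, ‖(A' g).eval z - h.eval z * (B' g).eval z‖ <
      1 / ((n : ℝ) + 1) * ‖(B' g).eval z‖ := by
    refine hK.eventually_forall_of_forall_eventually fun z hz => ?_
    have hh : ContinuousAt (fun w : HolFun Ω × ℂ => h.eval w.2) (f, z) := by fun_prop
    exact ((hc z).1.sub (hh.mul (hc z).2)).norm.eventually_lt
      (continuousAt_const.mul (hc z).2.norm) (hAK z hz)
  have h2 : ∀ᶠ g in 𝓝 f, ∀ z ∈ innerCompact Ω n,
      ‖(A' g).eval z - g.toFun z * (B' g).eval z‖ <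
      1 / ((n : ℝ) + 1) * ‖(B' g).eval z‖ := by
    refine (isCompact_innerCompact Ω n).eventually_forall_of_forall_eventually fun z hz => ?_
    have hh := continuousAt_toFun_eval hΩ f (innerCompact_subset Ω n hz)
    exact ((hc z).1.sub (hh.mul (hc z).2)).norm.eventually_lt
      (continuousAt_const.mul (hc z).2.norm) (hAL z hz)
  filter_upwards [h1, h2, (isOpen_setOf_memPadeD ha p q).mem_nhds hD] with g hg1 hg2 hgD
  exact ⟨p, q, A' g, B' g, hpq, hgD, (hA'B' g hgD).1, hg1, hg2⟩

theorem dense_padeApproxSet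
    (h𝔉 : ∃ u : ℕ → ℕ × ℕ, (∀ n, u n ∈ 𝔉) ∧ Tendsto (fun n => (u n).1) atTop atTop)
    (hΩ : IsOpen Ω) (hΩs : IsSimplyConnected Ω) (hζ : ζ ∈ Ω) (hK : IsCompact K)
    (hKΩ : K ⊆ Ωᶜ) (hKc : IsPreconnected Kᶜ) (h : ℂ[X]) (n : ℕ) :
    Dense (padeApproxSet 𝔉 Ω ζ K h n) := by
  intro f
  refine mem_closure_of_forall_innerCompact hΩ fun N δ hδ => ?_
  set ε : ℝ := min δ (1 / ((n : ℝ) + 1)) with hε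
  have hε0 : 0 < ε := lt_min hδ (by positivity)
  obtain ⟨P, hPL, hPK⟩ := exists_polynomial_near hΩ hΩs hK hKΩ hKc N f.differentiableOn_toFun h
    (half_pos hε0)
  obtain ⟨u, hu, hut⟩ := h𝔉
  obtain ⟨k, hk⟩ := (hut.eventually_gt_atTop P.natDegree).exists
  obtain ⟨M, hM⟩ := (((isCompact_innerCompact Ω N).union hK).image
    (f := fun z : ℂ => (z - ζ) ^ (u k).1) (by fun_prop)).isBounded.exists_norm_le
  set η : ℝ := ε / 2 / (|M| + 1) with hη
  have hη0 : 0 < η := by positivity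
  have hsmall : ∀ z ∈ innerCompact Ω N ∪ K, ‖(η : ℂ) * (z - ζ) ^ (u k).1‖ < ε / 2 := by
    intro z hz
    have h1 : ‖(z - ζ) ^ (u k).1‖ < |M| + 1 :=
      (hM _ ⟨z, hz, rfl⟩).trans_lt (by linarith [le_abs_self M])
    rw [norm_mul, Complex.norm_real, Real.norm_of_nonneg hη0.le]
    calc η * ‖(z - ζ) ^ (u k).1‖ < η * (|M| + 1) := by gcongr
      _ = ε / 2 := div_mul_cancel₀ _ (by positivity)
  -- The added term is below `ε / 2` on both compacts, and since `deg P < (u k).1` it alone supplies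
  -- the nonzero coefficient that makes the Hankel determinant nonzero.
  set Q : ℂ[X] := P + C (η : ℂ) * (X - C ζ) ^ (u k).1 with hQ
  have hQe : ∀ z, Q.eval z = P.eval z + η * (z - ζ) ^ (u k).1 := fun z => by simp [hQ]
  have hQd : Q.natDegree ≤ (u k).1 := by
    refine (natDegree_add_le _ _).trans (max_le hk.le ?_)
    refine (natDegree_C_mul_le _ _).trans ?_
    rw [natDegree_pow, natDegree_X_sub_C, mul_one]
  have hQc : (taylor ζ Q).coeff (u k).1 ≠ 0 := by
    have h1 : taylor ζ Q = taylor ζ P + C (η : ℂ) * X ^ (u k).1 := by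
      simp [hQ, taylor_mul, taylor_pow]
    rw [h1, coeff_add, coeff_C_mul_X_pow, if_pos rfl,
      Polynomial.coeff_eq_zero_of_natDegree_lt (by rwa [natDegree_taylor]), zero_add]
    exact_mod_cast hη0.ne'
  have hdiff : DifferentiableOn ℂ (fun z => Q.eval z) Ω := Q.differentiable.differentiableOn
  have hg : ∀ z ∈ Ω, (HolFun.ofDifferentiableOn hdiff).toFun z = Q.eval z := fun z hz =>
    HolFun.toFun_ofDifferentiableOn hdiff hz
  have hser : taylorSeriesAt (HolFun.ofDifferentiableOn hdiff).toFun ζ =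
      (taylor ζ Q : PowerSeries ℂ) :=
    taylorSeriesAt_eq_of_eventuallyEq (eventually_of_mem (hΩ.mem_nhds hζ) hg)
  refine ⟨HolFun.ofDifferentiableOn hdiff, ⟨(u k).1, (u k).2, Q, 1, hu k, ?_, ?_, ?_, ?_⟩, ?_⟩
  · rw [hser]
    exact memPadeD_taylor hQd hQc _
  · rw [hser]
    exact isPadePair_self hQd ζ _
  · intro z hz
    rw [eval_one, mul_one, norm_one, mul_one, hQe]
    have h1 := hPK z hz
    have h2 := hsmall z (Or.inr hz)
    have h3 := norm_add_le (P.eval z - h.eval z) (η * (z - ζ) ^ (u k).1)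
    rw [sub_add_eq_add_sub] at h3
    have h4 : ε ≤ 1 / ((n : ℝ) + 1) := min_le_right _ _
    linarith
  · intro z hz
    rw [eval_one, mul_one, norm_one, mul_one, hg z (innerCompact_subset Ω n hz), sub_self,
      norm_zero]
    positivity
  · intro z hz
    rw [hg z (innerCompact_subset Ω N hz), hQe]
    have h1 := hPL z hz
    have h2 := hsmall z (Or.inl hz)
    have h3 := norm_add_le (P.eval z - f.toFun z) (η * (z - ζ) ^ (u k).1)
    rw [sub_add_eq_add_sub] at h3
    have h4 : ε ≤ δ := min_le_left _ _
    linarith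

theorem IsPadeUniversal.mem_padeApproxSet {f : HolFun Ω} (hf : IsPadeUniversal 𝔉 Ω ζ f)
    (hK : IsCompact K) (hKΩ : K ⊆ Ωᶜ) (hKc : IsConnected Kᶜ) (h : ℂ[X]) (n : ℕ) :
    f ∈ padeApproxSet 𝔉 Ω ζ K h n := by
  obtain ⟨p, q, Φ, hpq, hD, hΦ, h1, h2⟩ := hf h K hK hKΩ hKc
  have hpos : (0 : ℝ≥0∞) < ENNReal.ofReal (1 / ((n : ℝ) + 1)) :=
    ENNReal.ofReal_pos.2 (by positivity)
  obtain ⟨k, hk1, hk2⟩ := ((h1.eventually_lt_const hpos).and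
    ((h2 _ (isCompact_innerCompact Ω n) (innerCompact_subset Ω n)).eventually_lt_const
      hpos)).exists
  obtain ⟨A, B, hAB, hΦk⟩ := isPadeApproximant_iff.1 (hΦ k)
  rw [hΦk] at hk1 hk2
  exact ⟨p k, q k, A, B, hpq k, hD k, hAB, fun z hz => hAB.norm_sub_lt (hD k) hk1 hz,
    fun z hz => hAB.norm_sub_lt (hD k) hk2 hz⟩

/-- The enlarged compact does not depend on `n`, while both the approximation of `h` by `H` and the
Padé accuracy improve with `n`, so choosing one approximant for each `n` gives the sequence. -/
theorem isPadeUniversal_of_forall_mem (hΩ : IsOpen Ω) (hΩc : IsConnected Ω) {H : Set ℂ[X]}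
    (hH : ∀ (h : ℂ[X]) (K : Set ℂ), IsCompact K → ∀ ε > 0,
      ∃ h' ∈ H, ∀ z ∈ K, ‖h'.eval z - h.eval z‖ < ε) {f : HolFun Ω}
    (hf : ∀ i, IsConnected (outerCompact Ω i)ᶜ → ∀ h ∈ H, ∀ n,
      f ∈ padeApproxSet 𝔉 Ω ζ (outerCompact Ω i) h n) : IsPadeUniversal 𝔉 Ω ζ f := by
  intro h K hK hKΩ hKc
  obtain ⟨i, hi, hKi⟩ := exists_subset_outerCompact hΩc hK hKΩ hKc
  choose h' hh'H hh' using fun n : ℕ => hH h (outerCompact Ω i) (isCompact_outerCompact hΩ i)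
    (1 / ((n : ℝ) + 1)) (by positivity)
  choose p q A B hpq hD hAB hAK hAL using fun n : ℕ => hf i hi (h' n) (hh'H n) n
  have hlim := tendsto_one_div_add_atTop_nhds_zero_nat (𝕜 := ℝ)
  refine ⟨p, q, fun n => algebraMap ℂ[X] (RatFunc ℂ) (A n) / algebraMap ℂ[X] (RatFunc ℂ) (B n),
    hpq, hD, fun n => isPadeApproximant_iff.2 ⟨A n, B n, hAB n, rfl⟩, ?_, fun L hL hLΩ => ?_⟩
  -- One `1 / (n + 1)` comes from the Padé approximant against `h' n`, the other from `h' n` against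
  -- `h`.
  · have h1 : Tendsto (fun n : ℕ => ENNReal.ofReal (2 * (1 / ((n : ℝ) + 1)))) atTop (𝓝 0) := by
      simpa using ENNReal.tendsto_ofReal (hlim.const_mul 2)
    refine tendsto_of_tendsto_of_tendsto_of_le_of_le tendsto_const_nhds h1 (fun _ => zero_le)
      fun n => (hAB n).ratSupDist_le fun z hz => ?_
    have h2 := hAK n z (hKi hz)
    have h3 := hh' n z (hKi hz)
    have h4 : (A n).eval z - h.eval z * (B n).eval z =
        ((A n).eval z - (h' n).eval z * (B n).eval z) +
        ((h' n).eval z - h.eval z) * (B n).eval z := by ring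
    have h5 := norm_add_le ((A n).eval z - (h' n).eval z * (B n).eval z)
      (((h' n).eval z - h.eval z) * (B n).eval z)
    rw [← h4, norm_mul] at h5
    have h6 := mul_le_mul_of_nonneg_right h3.le (norm_nonneg ((B n).eval z))
    linarith
  · have h1 : Tendsto (fun n : ℕ => ENNReal.ofReal (1 / ((n : ℝ) + 1))) atTop (𝓝 0) := by
      simpa using ENNReal.tendsto_ofReal hlim
    refine tendsto_of_tendsto_of_tendsto_of_le_of_le' tendsto_const_nhds h1
      (Eventually.of_forall fun _ => zero_le) ?_
    filter_upwards [eventually_subset_innerCompact hΩ hL hLΩ] with n hn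
    exact (hAB n).ratSupDist_le fun z hz => hAL n z (hn hz)

end Universality

theorem theorem3p3 (𝔉 : Set (ℕ × ℕ))
    (h𝔉 : ∃ u : ℕ → ℕ × ℕ, (∀ n, u n ∈ 𝔉) ∧ Tendsto (fun n => (u n).1) atTop atTop)
    (Ω : Set ℂ) (hΩ : IsOpen Ω) (hΩs : IsSimplyConnected Ω) (ζ : ℂ) (hζ : ζ ∈ Ω) :
    (∃ f : HolFun Ω, IsPadeUniversal 𝔉 Ω ζ f) ∧
      Dense {f : HolFun Ω | IsPadeUniversal 𝔉 Ω ζ f} ∧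
      IsGδ {f : HolFun Ω | IsPadeUniversal 𝔉 Ω ζ f} := by
  have hΩc : IsConnected Ω := hΩs.isPathConnected.isConnected
  have := baireSpace_holFun hΩ
  obtain ⟨H, hHc, hH⟩ := exists_countable_polynomials_dense
  have : Countable H := hHc.to_subtype
  have heq : {f : HolFun Ω | IsPadeUniversal 𝔉 Ω ζ f} =
      ⋂ j : {i // IsConnected (outerCompact Ω i)ᶜ} × H × ℕ,
        padeApproxSet 𝔉 Ω ζ (outerCompact Ω j.1) j.2.1 j.2.2 := by
    ext f
    rw [Set.mem_iInter]
    refine ⟨fun hf j => hf.mem_padeApproxSet (isCompact_outerCompact hΩ _)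
      (outerCompact_subset Ω _) j.1.2 _ _, fun hf =>
      isPadeUniversal_of_forall_mem hΩ hΩc hH fun i hi h hh n => hf (⟨i, hi⟩, ⟨h, hh⟩, n)⟩
  have ho : ∀ j : {i // IsConnected (outerCompact Ω i)ᶜ} × H × ℕ,
      IsOpen (padeApproxSet 𝔉 Ω ζ (outerCompact Ω j.1) j.2.1 j.2.2) := fun j =>
    isOpen_padeApproxSet hΩ hζ (isCompact_outerCompact hΩ _) _ _
  have hd : Dense {f : HolFun Ω | IsPadeUniversal 𝔉 Ω ζ f} := by
    rw [heq]
    exact dense_iInter_of_isOpen ho fun j => dense_padeApproxSet h𝔉 hΩ hΩs hζ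
      (isCompact_outerCompact hΩ _) (outerCompact_subset Ω _) j.1.2.isPreconnected _ _
  refine ⟨?_, hd, ?_⟩
  · have : Nonempty (HolFun Ω) :=
      ⟨HolFun.ofDifferentiableOn (F := fun _ => 0) (differentiableOn_const 0)⟩
    exact hd.nonempty
  · rw [heq]
    exact .iInter_of_isOpen ho
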